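/- \textbf{Definitions.} Let $\mathcal X$ be a measurable space (for $\mathcal X\subseteq\mathbb R^n$, the Borel $\sigma$-algebra) and let $\mathcal H$ be a set of functions $\mathcal X\to\{\pm1\}$. For a probability measure $\mathcal D$ on $\mathcal X$ and a measurable $f:\mathcal X\to\{\pm1\}$ put $\mathrm{dist}_{\mathcal D}(f,\mathcal H)=\inf_{h\in\mathcal H}\Pr_{x\sim\mathcal D}[f(x)\ne h(x)]$. The VC dimension $\mathsf{VC}(\mathcal H)$ is the largest size of a finite set on which every $\pm1$-labelling is realised by some member of $\mathcal H$. A distribution-free sample $\epsilon$-tester for $\mathcal H$ with $m$ samples is a randomized algorithm that, for every unknown $\mathcal D$ and $f$, receives $m$ independent labelled examples $(x,f(x))$ with $x\sim\mathcal D$, accepts with probability at least $2/3$ if $f\in\mathcal H$, and rejects with probability at least $2/3$ if $\mathrm{dist}_{\mathcal D}(f,\mathcal H)>\epsilon$; $m_\epsilon(\mathcal H)$ denotes the least such $m$ ($\infty$ if there is none). A $(0,\epsilon)$-tolerant tester with $q$ queries is a randomized adaptive algorithm that, for every unknown $\mathcal D$ and $f$, obtains at most $q$ labels in total, each time either drawing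 a random example $(x,f(x))$, $x\sim\mathcal D$, or querying $f(x)$ at a point $x\in\mathcal X$ of its choice, accepts with probability at least $2/3$ if $\mathrm{dist}_{\mathcal D}(f,\mathcal H)=0$, and rejects with probability at least $2/3$ if $\mathrm{dist}_{\mathcal D}(f,\mathcal H)\ge\epsilon$; $q_{0,\epsilon}(\mathcal H)$ denotes the least such $q$ ($\infty$ if there is none). Let $\mathrm{sign}(t)=+1$ for $t\ge0$ and $-1$ for $t<0$. A Dudley class on $\mathcal X$ is a set of the form $\{x\mapsto\mathrm{sign}(f(x)+h(x)) : f\in\mathcal F\}$, where $\mathcal F$ is a real vector space of functions $\mathcal X\to\mathbb R$ and $h:\mathcal X\to\mathbb R$ is fixed. If $\mathcal X\subseteq\mathbb R^n$, it is called analytic if for some such $\mathcal F$ and $h$, the function $h$ and every $f\in\mathcal F$ are restrictions to $\mathcal X$ of functions that are real analytic on a neighbourhood of $\mathcal X$. \textbf{Theorem.} There are absolute constants $\epsilon_0>0$ and $c>0$ such that for every $0<\epsilon<\epsilon_0$ the following hold. (0) For every $n$, every connected $\mathcal X\subseteq\mathbb R^n$ with non-empty interior (for instance $\mathcal X=\mathbb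 R^n$ or $\mathcal X=[0,1]^n$) and every analytic Dudley class $\mathcal H$ on $\mathcal X$ with $\mathsf{VC}(\mathcal H)=d$, $2\le d<\infty$: \[ m_\epsilon(\mathcal H)\ge c\,\frac{d}{\log d}\quad\text{and}\quad q_{0,\epsilon}(\mathcal H)\ge c\,\frac{d}{\log d}. \] (1) For all $n,k\ge1$, the class $\mathcal H$ of polynomial threshold functions $x\mapsto\mathrm{sign}(p(x))$ on $\mathbb R^n$, $p$ a real polynomial of total degree at most $k$, satisfies, with $N=\binom{n+k}{k}$, \[ m_\epsilon(\mathcal H),\ q_{0,\epsilon}(\mathcal H)\ \ge\ c\,\frac{N}{\log N}. \] (2) For all $n\ge2$, the class $\mathcal H$ of balls in $\mathbb R^n$, i.e. of functions $x\mapsto\mathrm{sign}(t-\|x-z\|_2)$ with $t\in\mathbb R$, $z\in\mathbb R^n$, satisfies \[ m_\epsilon(\mathcal H),\ q_{0,\epsilon}(\mathcal H)\ \ge\ c\,\frac{n}{\log n}. \] (3) For all $d\ge2$, the class $\mathcal H$ of functions on $\mathbb R^2$ of the form $(x,y)\mapsto\mathrm{sign}\bigl(t+\sum_{k=1}^d a_k\cos(kx)+\sum_{k=1}^d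 b_k\sin(kx)-y\bigr)$ with $t,a_k,b_k\in\mathbb R$ satisfies \[ m_\epsilon(\mathcal H),\ q_{0,\epsilon}(\mathcal H)\ \ge\ c\,\frac{d}{\log d}. \] -/

import Mathlib

open MeasureTheory
open scoped ENNReal

noncomputable section

namespace DudleyTesting

/-! ### Boolean-valued functions, VC dimension, distance

Labels are Boolean: `true` stands for `+1` (or `1`) and `false` for `-1` (or `0`). -/

/-- A finite set `T` is shattered by `H` if every labelling of `T` is realised by some `g ∈ H`. -/
def Shattered {𝒳 : Type*} (H : Set (𝒳 → Bool)) (T : Finset 𝒳) : Prop :=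
  ∀ l : 𝒳 → Bool, ∃ g ∈ H, ∀ x ∈ T, g x = l x

/-- The VC dimension: the largest size of a shattered finite set (`⊤` if unbounded). -/
def vcDim {𝒳 : Type*} (H : Set (𝒳 → Bool)) : ℕ∞ :=
  ⨆ (T : Finset 𝒳) (_ : Shattered H T), (T.card : ℕ∞)

/-- `dist_D(f, H) = inf_{h ∈ H} Pr_{x ∼ D}[f x ≠ h x]`, with value `⊤` if `H` is empty. -/
def distToClass {𝒳 : Type*} [MeasurableSpace 𝒳] (D : Measure 𝒳) (f : 𝒳 → Bool)
    (H : Set (𝒳 → Bool)) : ℝ≥0∞ :=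
  ⨅ h ∈ H, D {x | f x ≠ h x}

/-! ### Sample-based testers -/

/-- A randomized algorithm that sees `m` labelled examples: its internal randomness is a random
seed from an arbitrary probability space. -/
structure SampleAlgorithm (𝒳 : Type*) [MeasurableSpace 𝒳] (m : ℕ) where
  Seed : Type
  [seedSpace : MeasurableSpace Seed]
  seedLaw : Measure Seed
  [isProb : IsProbabilityMeasure seedLaw]
  output : Seed × (Fin m → 𝒳 × Bool) → Bool
  measurable_output : Measurable output

attribute [instance] SampleAlgorithm.seedSpace SampleAlgorithm.isProb

/-- The probability that `A` outputs `b` on `m` independent examples `(x, f x)`, `x ∼ D`. -/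
def SampleAlgorithm.outputProb {𝒳 : Type*} [MeasurableSpace 𝒳] {m : ℕ} (A : SampleAlgorithm 𝒳 m)
    (f : 𝒳 → Bool) (D : Measure 𝒳) (b : Bool) : ℝ≥0∞ :=
  (A.seedLaw.prod (Measure.pi fun _ : Fin m => D))
    {p | A.output (p.1, fun i => (p.2 i, f (p.2 i))) = b}

/-- `A` is a distribution-free (two-sided) sample `ε`-tester for `H`. -/
def SampleAlgorithm.IsTester {𝒳 : Type*} [MeasurableSpace 𝒳] {m : ℕ} (A : SampleAlgorithm 𝒳 m)
    (H : Set (𝒳 → Bool)) (ε : ℝ) : Prop :=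
  ∀ (D : Measure 𝒳) [IsProbabilityMeasure D] (f : 𝒳 → Bool), Measurable f →
    (f ∈ H → 2 / 3 ≤ A.outputProb f D true) ∧
    (ENNReal.ofReal ε < distToClass D f H → 2 / 3 ≤ A.outputProb f D false)

/-- The least number of examples of a distribution-free sample `ε`-tester for `H`
(`⊤` if there is no such tester). -/
def sampleComplexity {𝒳 : Type*} [MeasurableSpace 𝒳] (H : Set (𝒳 → Bool)) (ε : ℝ) : ℕ∞ :=
  ⨅ (m : ℕ) (_ : ∃ A : SampleAlgorithm 𝒳 m, A.IsTester H ε), (m : ℕ∞)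

/-! ### Adaptive query testers -/

/-- A randomized adaptive algorithm that obtains `q` labels. After `k` labels have been obtained,
`move k` reads the seed and the `k` labelled points seen so far and either asks for a fresh random
example (`Sum.inl ()`) or queries a point `x` (`Sum.inr x`). Stopping earlier is covered, as
the remaining labels may be ignored. -/
structure QueryAlgorithm (𝒳 : Type*) [MeasurableSpace 𝒳] (q : ℕ) where
  Seed : Type
  [seedSpace : MeasurableSpace Seed]
  seedLaw : Measure Seed
  [isProb : IsProbabilityMeasure seedLaw]
  move : (k : ℕ) → Seed × (Fin k → 𝒳 × Bool) → Unit ⊕ 𝒳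
  measurable_move : ∀ k, Measurable (move k)
  output : Seed × (Fin q → 𝒳 × Bool) → Bool
  measurable_output : Measurable output

attribute [instance] QueryAlgorithm.seedSpace QueryAlgorithm.isProb

/-- The first `k` labelled points of a run with seed `ω`, where `xs i` is the random point used
if step `i` asks for a random example. -/
def QueryAlgorithm.transcript {𝒳 : Type*} [MeasurableSpace 𝒳] {q : ℕ} (A : QueryAlgorithm 𝒳 q)
    (f : 𝒳 → Bool) (ω : A.Seed) (xs : Fin q → 𝒳) : (k : ℕ) → k ≤ q → (Fin k → 𝒳 × Bool)
  | 0, _ => Fin.elim0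
  | k + 1, hk =>
    let prev := A.transcript f ω xs k (Nat.le_of_succ_le hk)
    let x : 𝒳 := Sum.elim (fun _ => xs ⟨k, hk⟩) id (A.move k (ω, prev))
    Fin.snoc (α := fun _ => 𝒳 × Bool) prev (x, f x)

/-- The probability that `A` outputs `b` on the function `f` and the distribution `D`. -/
def QueryAlgorithm.outputProb {𝒳 : Type*} [MeasurableSpace 𝒳] {q : ℕ} (A : QueryAlgorithm 𝒳 q)
    (f : 𝒳 → Bool) (D : Measure 𝒳) (b : Bool) : ℝ≥0∞ :=
  (A.seedLaw.prod (Measure.pi fun _ : Fin q => D))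
    {p | A.output (p.1, A.transcript f p.1 p.2 q le_rfl) = b}

/-- `A` is an `(ε₁, ε₂)`-tolerant distribution-free tester for `H`. -/
def QueryAlgorithm.IsTolerantTester {𝒳 : Type*} [MeasurableSpace 𝒳] {q : ℕ}
    (A : QueryAlgorithm 𝒳 q) (H : Set (𝒳 → Bool)) (ε₁ ε₂ : ℝ) : Prop :=
  ∀ (D : Measure 𝒳) [IsProbabilityMeasure D] (f : 𝒳 → Bool), Measurable f →
    (distToClass D f H ≤ ENNReal.ofReal ε₁ → 2 / 3 ≤ A.outputProb f D true) ∧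
    (ENNReal.ofReal ε₂ ≤ distToClass D f H → 2 / 3 ≤ A.outputProb f D false)

/-- The least number of labels (sampled or queried) of an adaptive `(ε₁, ε₂)`-tolerant
distribution-free tester for `H` (`⊤` if there is no such tester). -/
def tolerantQueryComplexity {𝒳 : Type*} [MeasurableSpace 𝒳] (H : Set (𝒳 → Bool))
    (ε₁ ε₂ : ℝ) : ℕ∞ :=
  ⨅ (q : ℕ) (_ : ∃ A : QueryAlgorithm 𝒳 q, A.IsTolerantTester H ε₁ ε₂), (q : ℕ∞)

/-- Both the sample complexity of `ε`-testing `H` and the query complexity of `(0, ε)`-tolerantly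
testing `H` are at least `c * (N / log N)`. -/
def TestingLowerBound {𝒳 : Type*} [MeasurableSpace 𝒳] (H : Set (𝒳 → Bool)) (ε c : ℝ)
    (N : ℕ) : Prop :=
  ENNReal.ofReal (c * (N / Real.log N)) ≤ (sampleComplexity H ε : ℝ≥0∞) ∧
  ENNReal.ofReal (c * (N / Real.log N)) ≤ (tolerantQueryComplexity H 0 ε : ℝ≥0∞)

/-! ### Dudley classes -/

/-- The sign of a real number as a label, with `sign 0 = +1`. -/
def sgn (t : ℝ) : Bool := decide (0 ≤ t)

/-- The Dudley class with vector space `F` and threshold `h`. -/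
def dudleyClass {𝒳 : Type*} (F : Submodule ℝ (𝒳 → ℝ)) (h : 𝒳 → ℝ) : Set (𝒳 → Bool) :=
  {g | ∃ f ∈ F, ∀ x, g x = sgn (f x + h x)}

/-- A real function on a set `X ⊆ ℝⁿ` is analytic if it is the restriction to `X` of a function
that has a convergent power series expansion around each point of `X`. -/
def IsAnalytic {n : ℕ} {X : Set (EuclideanSpace ℝ (Fin n))} (f : X → ℝ) : Prop :=
  ∃ φ : EuclideanSpace ℝ (Fin n) → ℝ, AnalyticOnNhd ℝ φ X ∧ ∀ x : X, f x = φ x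

/-- A Dudley class on `X ⊆ ℝⁿ` whose threshold and vector space consist of analytic functions. -/
def IsAnalyticDudleyClass {n : ℕ} {X : Set (EuclideanSpace ℝ (Fin n))}
    (H : Set (X → Bool)) : Prop :=
  ∃ (F : Submodule ℝ (X → ℝ)) (h : X → ℝ),
    (∀ f ∈ F, IsAnalytic f) ∧ IsAnalytic h ∧ H = dudleyClass F h

/-- Degree-`k` polynomial threshold functions on `ℝⁿ`. -/
def ptfClass (n k : ℕ) : Set (EuclideanSpace ℝ (Fin n) → Bool) :=
  {g | ∃ p : MvPolynomial (Fin n) ℝ, p.totalDegree ≤ k ∧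
    ∀ x, g x = sgn (MvPolynomial.eval (fun i => x i) p)}

/-- Balls in `ℝⁿ`. -/
def ballClass (n : ℕ) : Set (EuclideanSpace ℝ (Fin n) → Bool) :=
  {g | ∃ (t : ℝ) (z : EuclideanSpace ℝ (Fin n)), ∀ x, g x = sgn (t - ‖x - z‖)}

/-- Signs of degree-`d` trigonometric polynomials in the plane. -/
def trigClass (d : ℕ) : Set (EuclideanSpace ℝ (Fin 2) → Bool) :=
  {g | ∃ (t : ℝ) (a b : ℕ → ℝ), ∀ p : EuclideanSpace ℝ (Fin 2),
    g p = sgn (t + ∑ k ∈ Finset.Icc 1 d, a k * Real.cos (k * p 0)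
      + ∑ k ∈ Finset.Icc 1 d, b k * Real.sin (k * p 0) - p 1)}

end DudleyTesting

end

open MeasureTheory
open scoped ENNReal

noncomputable section

namespace DudleyTesting

/-! A tester that sees too few labels cannot tell a distribution carried by `d` points from one
spread over `100 * d` points. Take `100 * d` points, every `d` of which are shattered, and label
them at random. On a law carried by `d` of them each labelling agrees with some member of the class
and has to be accepted. On a law with weight one at most of them, Sauer–Shelah shows that most
labellings disagree with every member on a constant fraction of the mass and have to be rejected.
Averaging over the labellings (`no_finite_tester`) turns a tester into a procedure that recognises
small support from unlabelled samples.

`support_size_lower_bound` excludes such a procedure by the method of moments. Draw the point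
weights independently from one of two laws, one almost entirely at `0` and the other almost entirely
at `1`, with equal moments up to order `M`, where `M` is of order `log d` (`exists_matchingLaws`). A
sample in which no point occurs more than `M` times has the same expected weight under both laws,
and the other samples are negligible (`matching_transfer`). Random weights are never normalised:
everything is compared with the `m`-th power of the total mass. The laws come from the alternating
central binomial coefficients, which annihilate low-degree polynomials in `k ^ 2` and decay like a
Gaussian of variance `M`; the decay gives exponential moments at scale `1 / M`, hence the bound `d /
log d`.

For Dudley classes the points are chosen one at a time, avoiding the zeros of finitely many nonzero
analytic functions; by the identity theorem these zeros cannot cover an open set. Dudley's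
inequality, VC dimension at most rank, links rank and VC dimension, and the concrete classes only
need a lower bound on the rank. -/

/-! ### Alternating central binomial weights -/

/-- The weight of `±(j + 1)` in the alternating central binomial sum, normalised at `0`. -/
def altWeight (M j : ℕ) : ℝ :=
  2 * (-1) ^ (j + 1) * ((2 * M).choose (M + (j + 1)) / (2 * M).choose M)

lemma sum_range_two_mul_add_one (f : ℕ → ℝ) (M : ℕ) :
    ∑ k ∈ Finset.range (2 * M + 1), f k =
      f M + ∑ j ∈ Finset.range M, (f (M + (j + 1)) + f (M - 1 - j)) := by
  rw [show 2 * M + 1 = (M + 1) + M by ring, Finset.sum_range_add, Finset.sum_range_succ,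
    Finset.sum_add_distrib, Finset.sum_range_reflect f M]
  simp only [add_assoc, add_comm 1]
  ring

/-- The `2 * M`-th finite difference kills `t ^ (2 * i)`. Started at `-M`, its terms at `j + 1` and
`-(j + 1)` coincide because power and binomials are even, and `0 ^ i` is the central term. So mass
`1` at `0` and `altWeight M j` at `(j + 1) ^ 2` form a signed measure annihilating polynomials of
degree below `M`. -/
lemma sum_altWeight_mul_sq_pow {M i : ℕ} (hi : i < M) :
    (0 : ℝ) ^ i + ∑ j ∈ Finset.range M, altWeight M j * (((j : ℝ) + 1) ^ 2) ^ i = 0 := by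
  have h := congrFun (fwdDiff_iter_pow_eq_zero_of_lt (R := ℝ) (j := 2 * i) (n := 2 * M)
    (by omega)) (-(M : ℝ))
  rw [fwdDiff_iter_eq_sum_shift, sum_range_two_mul_add_one] at h
  have hc : ((2 * M).choose M : ℝ) ≠ 0 := by
    exact_mod_cast (Nat.choose_pos (by omega : M ≤ 2 * M)).ne'
  have hM : ∀ j ∈ Finset.range M, ((-1 : ℤ) ^ (2 * M - (M + (j + 1))) *
      ((2 * M).choose (M + (j + 1)) : ℤ)) • (-(M : ℝ) + (M + (j + 1)) • (1 : ℝ)) ^ (2 * i) +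
      ((-1 : ℤ) ^ (2 * M - (M - 1 - j)) * ((2 * M).choose (M - 1 - j) : ℤ)) •
        (-(M : ℝ) + (M - 1 - j) • (1 : ℝ)) ^ (2 * i) =
      (-1) ^ M * (2 * M).choose M * (altWeight M j * (((j : ℝ) + 1) ^ 2) ^ i) := by
    intro j hj
    have hj := Finset.mem_range.mp hj
    obtain ⟨t, rfl⟩ : ∃ t, M = j + 1 + t := ⟨M - (j + 1), by omega⟩
    have e1 : 2 * (j + 1 + t) - (j + 1 + t + (j + 1)) = t := by omega
    have e2 : j + 1 + t - 1 - j = t := by omega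
    have e3 : 2 * (j + 1 + t) - t = t + 2 * (j + 1) := by omega
    have e4 : (2 * (j + 1 + t)).choose t = (2 * (j + 1 + t)).choose (j + 1 + t + (j + 1)) := by
      rw [← Nat.choose_symm (by omega)]; congr 1; omega
    rw [e1, e2, e3, e4]
    unfold altWeight
    have s1 : (-(((j + 1 + t : ℕ) : ℝ)) + (j + 1 + t + (j + 1)) • (1 : ℝ)) ^ (2 * i)
        = (((j : ℝ) + 1) ^ 2) ^ i := by
      rw [pow_mul]; congr 1; simp; ring
    have s2 : (-(((j + 1 + t : ℕ) : ℝ)) + t • (1 : ℝ)) ^ (2 * i) = (((j : ℝ) + 1) ^ 2) ^ i := by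
      rw [pow_mul]; congr 1; simp; ring
    rw [s1, s2, pow_add _ t, pow_mul, zsmul_eq_mul, zsmul_eq_mul]
    push_cast
    have s3 : ((-1 : ℝ)) ^ (j + 1 + t) * (-1) ^ (j + 1) = (-1) ^ t := by
      rw [pow_add, mul_right_comm, ← pow_add, ← two_mul, pow_mul]; simp
    generalize hC : ((2 * (j + 1 + t)).choose (j + 1 + t) : ℝ) = C at hc
    rw [← s3]
    field_simp
    norm_num
  rw [Finset.sum_congr rfl hM, ← Finset.mul_sum] at h
  have s0 : ((-1 : ℤ) ^ (2 * M - M) * ((2 * M).choose M : ℤ)) •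
      (-(M : ℝ) + M • (1 : ℝ)) ^ (2 * i) = (-1) ^ M * (2 * M).choose M * (0 : ℝ) ^ i := by
    rw [show 2 * M - M = M by omega, zsmul_eq_mul, pow_mul]
    push_cast
    simp
  rw [s0, ← mul_add] at h
  exact (mul_eq_zero.mp h).resolve_left (mul_ne_zero (pow_ne_zero _ (by norm_num)) hc)

/-- The ratio of consecutive binomials is `1 - (2j + 1) / (M + j + 1)`, at most `exp (-(2j + 1) /
(2M))`, and the odd numbers sum to `j ^ 2`. -/
lemma choose_add_le_exp {M j : ℕ} (hj : j ≤ M) :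
    ((2 * M).choose (M + j) : ℝ) ≤ (2 * M).choose M * Real.exp (-((j : ℝ) ^ 2 / (2 * M))) := by
  induction j with
  | zero => simp
  | succ j ih =>
    have ih := ih (by omega)
    have h := Nat.choose_succ_right_eq (2 * M) (M + j)
    have hM : (0 : ℝ) < M := by exact_mod_cast (by omega : 0 < M)
    have hjM : (j : ℝ) + 1 ≤ M := by exact_mod_cast hj
    have h' : ((2 * M).choose (M + (j + 1)) : ℝ) * (M + j + 1) =
        (2 * M).choose (M + j) * (M - j) := by
      have := congrArg (Nat.cast (R := ℝ)) h
      rw [show 2 * M - (M + j) = M - j by omega] at this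
      push_cast [Nat.cast_sub (by omega : j ≤ M)] at this
      exact this
    have hpos : (0 : ℝ) < M + j + 1 := by positivity
    have key : ((M : ℝ) - j) ≤ (M + j + 1) * Real.exp (-((2 * j + 1) / (2 * M))) := by
      have h1 := Real.add_one_le_exp (-((2 * (j : ℝ) + 1) / (2 * M)))
      have h2 : ((M : ℝ) - j) / (M + j + 1) ≤ -((2 * (j : ℝ) + 1) / (2 * M)) + 1 := by
        rw [div_le_iff₀ hpos]
        have : (2 * (j : ℝ) + 1) / (2 * M) * (M + j + 1) ≤ 2 * j + 1 := by
          rw [div_mul_eq_mul_div, div_le_iff₀ (by positivity)]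
          nlinarith
        linarith
      have := (div_le_iff₀ hpos).mp (h2.trans h1)
      linarith
    have hexp : Real.exp (-(((j + 1 : ℕ) : ℝ) ^ 2 / (2 * M))) =
        Real.exp (-((j : ℝ) ^ 2 / (2 * M))) * Real.exp (-((2 * j + 1) / (2 * M))) := by
      rw [← Real.exp_add]; congr 1; push_cast; ring
    rw [hexp]
    refine le_of_mul_le_mul_right ?_ hpos
    rw [h']
    calc ((2 * M).choose (M + j) : ℝ) * (M - j)
        ≤ ((2 * M).choose M * Real.exp (-((j : ℝ) ^ 2 / (2 * M)))) *
          ((M + j + 1) * Real.exp (-((2 * j + 1) / (2 * M)))) := by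
          apply mul_le_mul ih key (by linarith) (by positivity)
      _ = _ := by ring

lemma abs_altWeight_le {M j : ℕ} (hj : j < M) :
    |altWeight M j| ≤ 2 * Real.exp (-(((j : ℝ) + 1) ^ 2 / (2 * M))) := by
  have hc : (0 : ℝ) < (2 * M).choose M := by
    exact_mod_cast Nat.choose_pos (by omega : M ≤ 2 * M)
  have h := choose_add_le_exp (show j + 1 ≤ M from hj)
  unfold altWeight
  rw [abs_mul, abs_mul, abs_pow]
  simp only [abs_neg, abs_one, one_pow, mul_one, abs_div, Nat.abs_cast, Nat.abs_ofNat]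
  gcongr
  rw [div_le_iff₀ hc]
  push_cast at h
  linarith

lemma sum_one_div_sq_le (M : ℕ) : ∑ j ∈ Finset.range M, 1 / ((j : ℝ) + 1) ^ 2 ≤ 2 := by
  have : ∑ j ∈ Finset.range M, 1 / ((j : ℝ) + 1) ^ 2 ≤ 2 - 1 / (M : ℝ) := by
    induction M with
    | zero => norm_num
    | succ M ih =>
      rw [Finset.sum_range_succ]
      rcases Nat.eq_zero_or_pos M with rfl | hM
      · norm_num
      have hM : (0 : ℝ) < M := by exact_mod_cast hM
      have : 1 / ((M : ℝ) + 1) ^ 2 ≤ 1 / M - 1 / (M + 1) := by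
        rw [div_sub_div _ _ hM.ne' (by positivity), div_le_div_iff₀ (by positivity) (by positivity)]
        nlinarith
      push_cast
      linarith
  refine this.trans ?_
  have : (0 : ℝ) ≤ 1 / (M : ℝ) := by positivity
  linarith

/-! ### Two laws with matching moments -/

/-- The common support of the two matching laws: `0`, `1`, `1000` and `10 ^ 6 * (j + 1) ^ 2`. -/
def matchPt (M : ℕ) : Fin 3 ⊕ Fin M → ℝ :=
  Sum.elim ![0, 1, 1000] fun j => 10 ^ 6 * ((j : ℝ) + 1) ^ 2

/-- The Cauchy transform at `a` of the alternating binomial weights. -/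
def altCauchy (M : ℕ) (a : ℝ) : ℝ :=
  -1 / a + ∑ j ∈ Finset.range M, altWeight M j / (10 ^ 6 * ((j : ℝ) + 1) ^ 2 - a)

/-- A signed measure on `matchPt` annihilating the polynomials of degree at most `M`. -/
def signedWeight (M : ℕ) : Fin 3 ⊕ Fin M → ℝ :=
  Sum.elim ![1, 1000 / 999 * altCauchy M 1, -(1000 / 999 * altCauchy M 1000)]
    fun j => altWeight M j *
      (1000 / ((10 ^ 6 * ((j : ℝ) + 1) ^ 2 - 1) * (10 ^ 6 * ((j : ℝ) + 1) ^ 2 - 1000)))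

lemma matchPt_tail_ge (j : ℕ) : (10 : ℝ) ^ 6 ≤ 10 ^ 6 * ((j : ℝ) + 1) ^ 2 := by
  have : (0 : ℝ) ≤ j := by positivity
  nlinarith

/-- The quotient `(x ^ c - a ^ c) / (x - a)` is a polynomial in `x` of degree below `M`, so the
alternating weights annihilate it; `-0 ^ c / a` is the contribution of the node `0`. -/
lemma altCauchy_mul_pow {M c : ℕ} (hc : c ≤ M) {a : ℝ} (ha : 0 < a) (ha' : a < 10 ^ 6) :
    altCauchy M a * a ^ c = -0 ^ c / a + ∑ j ∈ Finset.range M,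
      altWeight M j * (10 ^ 6 * ((j : ℝ) + 1) ^ 2) ^ c / (10 ^ 6 * ((j : ℝ) + 1) ^ 2 - a) := by
  induction c with
  | zero => simp [altCauchy]
  | succ c ih =>
    have h := sum_altWeight_mul_sq_pow (show c < M by omega)
    have h' : (0 : ℝ) ^ c + ∑ j ∈ Finset.range M,
        altWeight M j * (10 ^ 6 * ((j : ℝ) + 1) ^ 2) ^ c = 0 := by
      have h0 := congrArg ((10 ^ 6 : ℝ) ^ c * ·) h
      simp only [mul_add, ← mul_pow, mul_zero, Finset.mul_sum] at h0
      refine Eq.trans (congrArg ((0 : ℝ) ^ c + ·) (Finset.sum_congr rfl fun j _ => ?_)) h0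
      rw [mul_pow]
      ring
    rw [pow_succ, ← mul_assoc, ih (by omega), add_mul, Finset.sum_mul]
    have hs : ∀ j ∈ Finset.range M,
        altWeight M j * (10 ^ 6 * ((j : ℝ) + 1) ^ 2) ^ (c + 1) /
          (10 ^ 6 * ((j : ℝ) + 1) ^ 2 - a) =
        altWeight M j * (10 ^ 6 * ((j : ℝ) + 1) ^ 2) ^ c +
        altWeight M j * (10 ^ 6 * ((j : ℝ) + 1) ^ 2) ^ c /
          (10 ^ 6 * ((j : ℝ) + 1) ^ 2 - a) * a := by
      intro j _
      have : 10 ^ 6 * ((j : ℝ) + 1) ^ 2 - a ≠ 0 := by linarith [matchPt_tail_ge j]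
      rw [pow_succ]
      field_simp
      ring
    rw [Finset.sum_congr rfl hs, Finset.sum_add_distrib, div_mul_cancel₀ _ ha.ne']
    rw [pow_succ (0 : ℝ), mul_zero, neg_zero, zero_div, eq_neg_of_add_eq_zero_right h', zero_add]

/-- `signedWeight` divides the alternating measure by `(x - 1) * (x - 1000) / 1000`. By partial
fractions this produces Cauchy transforms at `1` and `1000`, which the atoms placed there cancel. -/
lemma sum_signedWeight_mul_pow {M c : ℕ} (hc : c ≤ M) :
    ∑ a, signedWeight M a * matchPt M a ^ c = 0 := by
  have h1 := altCauchy_mul_pow hc (a := 1) (by norm_num) (by norm_num)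
  have h2 := altCauchy_mul_pow hc (a := 1000) (by norm_num) (by norm_num)
  rw [Fintype.sum_sum_type, Fin.sum_univ_three,
    ← Fin.sum_univ_eq_sum_range (fun j : ℕ => _)] at *
  simp only [signedWeight, matchPt, Sum.elim_inl, Sum.elim_inr, Matrix.cons_val_zero,
    Matrix.cons_val_one, Matrix.cons_val]
  have h3 : ∀ j : Fin M, altWeight M j *
      (1000 / ((10 ^ 6 * ((j : ℝ) + 1) ^ 2 - 1) * (10 ^ 6 * ((j : ℝ) + 1) ^ 2 - 1000))) *
        (10 ^ 6 * ((j : ℝ) + 1) ^ 2) ^ c =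
      1000 / 999 * (altWeight M j * (10 ^ 6 * ((j : ℝ) + 1) ^ 2) ^ c /
        (10 ^ 6 * ((j : ℝ) + 1) ^ 2 - 1000)) -
      1000 / 999 * (altWeight M j * (10 ^ 6 * ((j : ℝ) + 1) ^ 2) ^ c /
        (10 ^ 6 * ((j : ℝ) + 1) ^ 2 - 1)) := by
    intro j
    have e1 : 10 ^ 6 * ((j : ℝ) + 1) ^ 2 - 1 ≠ 0 := by linarith [matchPt_tail_ge j]
    have e2 : 10 ^ 6 * ((j : ℝ) + 1) ^ 2 - 1000 ≠ 0 := by linarith [matchPt_tail_ge j]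
    generalize 10 ^ 6 * ((j : ℝ) + 1) ^ 2 = x at *
    field_simp
    ring
  rw [Finset.sum_congr rfl fun j _ => h3 j, Finset.sum_sub_distrib, ← Finset.mul_sum,
    ← Finset.mul_sum]
  linarith

lemma sum_fin_const_div_sq_le (M : ℕ) {C : ℝ} (hC : 0 ≤ C) :
    ∑ j : Fin M, C / ((j : ℝ) + 1) ^ 2 ≤ 2 * C := by
  rw [Fin.sum_univ_eq_sum_range (fun j : ℕ => C / ((j : ℝ) + 1) ^ 2)]
  have h : ∀ j ∈ Finset.range M, C / ((j : ℝ) + 1) ^ 2 = C * (1 / ((j : ℝ) + 1) ^ 2) :=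
    fun j _ => by ring
  rw [Finset.sum_congr rfl h, ← Finset.mul_sum]
  nlinarith [sum_one_div_sq_le M]

/-- The nodes from `10 ^ 6` on are too remote to matter, so at `1` and `1000` only the node `0`
counts. Hence `signedWeight` is about `1`, `-1.001`, `0.001` at `0`, `1`, `1000`. -/
lemma abs_altCauchy_sub_le (M : ℕ) {a : ℝ} (ha : a ≤ 1000) :
    |altCauchy M a - -1 / a| ≤ 6 / 10 ^ 6 := by
  unfold altCauchy
  rw [add_sub_cancel_left, ← Fin.sum_univ_eq_sum_range
    (fun j : ℕ => altWeight M j / (10 ^ 6 * ((j : ℝ) + 1) ^ 2 - a))]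
  refine (Finset.abs_sum_le_sum_abs _ _).trans
    ((Finset.sum_le_sum fun j _ => ?_).trans ((sum_fin_const_div_sq_le M (C := 3 / 10 ^ 6)
      (by norm_num)).trans (by norm_num)))
  have h1 := matchPt_tail_ge j
  have h2 : |altWeight M j| ≤ 2 := (abs_altWeight_le j.2).trans (by
    have : Real.exp (-(((j : ℕ) + 1 : ℝ) ^ 2 / (2 * M))) ≤ 1 := by
      rw [Real.exp_le_one_iff, neg_nonpos]; positivity
    linarith)
  rw [abs_div, abs_of_pos (a := 10 ^ 6 * ((j : ℝ) + 1) ^ 2 - a) (by linarith),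
    div_le_div_iff₀ (by linarith) (by positivity)]
  have : |altWeight M j| * ((j : ℝ) + 1) ^ 2 ≤ 2 * ((j : ℝ) + 1) ^ 2 := by gcongr
  linarith

/-- The bound on `θ` is the largest for which the Gaussian decay in `abs_altWeight_le` absorbs the
exponential. The two extra denominators of `signedWeight` then leave order `1 / x`. -/
lemma tail_weight_mul_exp_le {M : ℕ} (j : Fin M) {θ : ℝ} (hθ : θ ≤ 1 / (2 * 10 ^ 6 * M)) :
    |signedWeight M (Sum.inr j)| * Real.exp (θ * matchPt M (Sum.inr j)) *
      matchPt M (Sum.inr j) ≤ 3 / 10 ^ 3 / ((j : ℝ) + 1) ^ 2 := by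
  have hM : (0 : ℝ) < M := by exact_mod_cast j.pos
  simp only [signedWeight, matchPt, Sum.elim_inr]
  have h1 := matchPt_tail_ge j
  have ht : (1 : ℝ) ≤ ((j : ℝ) + 1) ^ 2 := by linarith
  have h2 : |altWeight M j| * Real.exp (θ * (10 ^ 6 * ((j : ℝ) + 1) ^ 2)) ≤ 2 := by
    refine (mul_le_mul_of_nonneg_right (abs_altWeight_le j.2) (Real.exp_pos _).le).trans ?_
    rw [mul_assoc, ← Real.exp_add]
    have : Real.exp (-(((j : ℕ) + 1 : ℝ) ^ 2 / (2 * M)) + θ * (10 ^ 6 * ((j : ℝ) + 1) ^ 2))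
        ≤ 1 := by
      rw [Real.exp_le_one_iff]
      have := mul_le_mul_of_nonneg_right hθ (by positivity : 0 ≤ 10 ^ 6 * ((j : ℝ) + 1) ^ 2)
      have e : 1 / (2 * 10 ^ 6 * (M : ℝ)) * (10 ^ 6 * ((j : ℝ) + 1) ^ 2) =
        ((j : ℝ) + 1) ^ 2 / (2 * M) := by field_simp
      linarith
    linarith
  generalize ((j : ℝ) + 1) ^ 2 = t at *
  have p1 : 0 < 10 ^ 6 * t - 1 := by linarith
  have p2 : 0 < 10 ^ 6 * t - 1000 := by linarith
  rw [abs_mul, abs_of_pos (a := 1000 / ((10 ^ 6 * t - 1) * (10 ^ 6 * t - 1000)))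
    (by positivity)]
  have h3 : 1000 / ((10 ^ 6 * t - 1) * (10 ^ 6 * t - 1000)) * (10 ^ 6 * t) ≤
      (3 / 10 ^ 3 / t) / 2 := by
    rw [div_mul_eq_mul_div, div_div, div_div, div_le_div_iff₀ (by positivity) (by positivity)]
    nlinarith
  calc _ = (|altWeight M j| * Real.exp (θ * (10 ^ 6 * t))) *
        (1000 / ((10 ^ 6 * t - 1) * (10 ^ 6 * t - 1000)) * (10 ^ 6 * t)) := by ring
    _ ≤ 2 * ((3 / 10 ^ 3 / t) / 2) := by
        apply mul_le_mul h2 h3 (by positivity) (by norm_num)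
    _ = _ := by ring

/-- Two probability laws on `matchPt M` with equal moments up to order `M`, the first one
concentrated at `0`, the second one at `1`. -/
structure MatchingLaws (M : ℕ) (w w' : Fin 3 ⊕ Fin M → ℝ) : Prop where
  nonneg : ∀ a, 0 ≤ w a
  nonneg' : ∀ a, 0 ≤ w' a
  sum_eq_one : ∑ a, w a = 1
  sum_eq_one' : ∑ a, w' a = 1
  moment_eq : ∀ c ≤ M, ∑ a, w a * matchPt M a ^ c = ∑ a, w' a * matchPt M a ^ c
  mean_ge : 9 / 10 ≤ ∑ a, w' a * matchPt M a
  exp_ne_zero_le : ∀ θ : ℝ, 0 ≤ θ → θ ≤ 1 / (2 * 10 ^ 6 * M) →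
    ∑ a, (if matchPt M a = 0 then 0 else w a * Real.exp (θ * matchPt M a)) ≤ 15 / 10 ^ 4
  exp_ne_one_le : ∀ θ : ℝ, 0 ≤ θ → θ ≤ 1 / (2 * 10 ^ 6 * M) →
    ∑ a, (if matchPt M a = 1 then 0 else w' a * Real.exp (θ * matchPt M a)) ≤ 1 / 10 ^ 3
  mul_exp_le : ∀ θ : ℝ, 0 ≤ θ → θ ≤ 1 / (2 * 10 ^ 6 * M) →
    ∑ a, w' a * matchPt M a * Real.exp (θ * matchPt M a) ≤ 101 / 100

lemma exp_le_of_small {t : ℝ} (ht : t ≤ 5 / 10 ^ 4) : Real.exp t ≤ 1001 / 1000 := by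
  have h := Real.add_one_le_exp (-t)
  rw [Real.exp_neg] at h
  have hp := Real.exp_pos t
  have : (-t + 1) * Real.exp t ≤ 1 := by
    have := mul_le_mul_of_nonneg_right h hp.le
    rwa [inv_mul_cancel₀ hp.ne'] at this
  nlinarith

/-- The laws are the positive and negative parts of `signedWeight`, divided by their common mass
`T`; the parts have equal mass because the zeroth moment vanishes. The atom of mass about `0.001` at
`1000` lets a law concentrated at `0` have mean close to one. -/
theorem exists_matchingLaws {M : ℕ} (hM : 0 < M) : ∃ w w', MatchingLaws M w w' := by
  have hM' : (1 : ℝ) ≤ M := by exact_mod_cast hM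
  set r := signedWeight M with hr
  set x := matchPt M with hx
  set T := ∑ a, max (r a) 0 with hT
  have hT' : T = ∑ a, max (-r a) 0 := by
    have h0 := sum_signedWeight_mul_pow (M := M) (c := 0) (by omega)
    simp only [pow_zero, mul_one] at h0
    rw [← sub_eq_zero, hT, ← Finset.sum_sub_distrib]
    exact (Finset.sum_congr rfl fun a _ => max_zero_sub_max_neg_zero_eq_self (r a)).trans h0
  have c1 := abs_le.mp (abs_altCauchy_sub_le M (a := 1) (by norm_num))
  have c2 := abs_le.mp (abs_altCauchy_sub_le M (a := 1000) le_rfl)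
  have r0 : r (Sum.inl 0) = 1 := rfl
  have r1 : r (Sum.inl 1) = 1000 / 999 * altCauchy M 1 := rfl
  have r2 : r (Sum.inl 2) = -(1000 / 999 * altCauchy M 1000) := rfl
  have x0 : x (Sum.inl 0) = 0 := rfl
  have x1 : x (Sum.inl 1) = 1 := rfl
  have x2 : x (Sum.inl 2) = 1000 := rfl
  have xj : ∀ j, 10 ^ 6 ≤ x (Sum.inr j) := fun j => matchPt_tail_ge j
  have xnn : ∀ a, 0 ≤ x a := by
    rintro (i | j)
    · fin_cases i
      exacts [x0.ge, by simp [x1], by simp [x2]]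
    · linarith [xj j]
  have r1' : r (Sum.inl 1) < -1 := by rw [r1]; norm_num at *; linarith
  have r1'' : -(1002 / 1000) < r (Sum.inl 1) := by rw [r1]; norm_num at *; linarith
  have r2' : 0 < r (Sum.inl 2) := by rw [r2]; norm_num at *; linarith
  have r2'' : r (Sum.inl 2) < 11 / 10 ^ 4 := by rw [r2]; norm_num at *; linarith
  have hT1 : 1 ≤ T := by
    have := Finset.single_le_sum (f := fun a => max (r a) 0) (fun a _ => le_max_right _ _)
      (Finset.mem_univ (Sum.inl 0))
    simp only [r0] at this
    exact (le_max_left _ _).trans this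
  have hTp : 0 < T := by linarith
  have tail : ∀ θ : ℝ, θ ≤ 1 / (2 * 10 ^ 6 * M) → ∑ j : Fin M, |r (Sum.inr j)| *
      Real.exp (θ * x (Sum.inr j)) * x (Sum.inr j) ≤ 6 / 10 ^ 3 := by
    intro θ hθ
    exact (Finset.sum_le_sum fun j _ => tail_weight_mul_exp_le j hθ).trans
      ((sum_fin_const_div_sq_le M (by norm_num)).trans (by norm_num))
  have tail' : ∀ θ : ℝ, θ ≤ 1 / (2 * 10 ^ 6 * M) → ∑ j : Fin M, |r (Sum.inr j)| *
      Real.exp (θ * x (Sum.inr j)) ≤ 6 / 10 ^ 9 := by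
    intro θ hθ
    have : 10 ^ 6 * ∑ j : Fin M, |r (Sum.inr j)| * Real.exp (θ * x (Sum.inr j)) ≤
        6 / 10 ^ 3 := by
      refine le_trans ?_ (tail θ hθ)
      rw [Finset.mul_sum]
      refine Finset.sum_le_sum fun j _ => ?_
      rw [mul_comm]
      exact mul_le_mul_of_nonneg_left (xj j) (by positivity)
    linarith
  have hle : ∀ t : ℝ, 0 ≤ t → t / T ≤ t := fun t ht => div_le_self ht hT1
  have hwle : ∀ a, max (r a) 0 / T ≤ |r a| := fun a =>
    (hle _ (le_max_right _ _)).trans (max_le (le_abs_self _) (abs_nonneg _))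
  have hwle' : ∀ a, max (-r a) 0 / T ≤ |r a| := fun a =>
    (hle _ (le_max_right _ _)).trans (max_le (neg_le_abs _) (abs_nonneg _))
  have hsmall : ∀ θ : ℝ, θ ≤ 1 / (2 * 10 ^ 6 * M) → θ ≤ 5 / 10 ^ 7 := by
    intro θ hθ
    refine hθ.trans ?_
    rw [div_le_div_iff₀ (by positivity) (by norm_num)]
    linarith
  have w'0 : max (-r (Sum.inl 0)) 0 = 0 := by rw [r0]; norm_num
  have w'1 : max (-r (Sum.inl 1)) 0 = -r (Sum.inl 1) := max_eq_left (by linarith)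
  have w'2 : max (-r (Sum.inl 2)) 0 = 0 := max_eq_right (by linarith)
  have w1 : max (r (Sum.inl 1)) 0 = 0 := max_eq_right (by linarith)
  have w2 : max (r (Sum.inl 2)) 0 = r (Sum.inl 2) := max_eq_left (by linarith)
  have xj0 : ∀ j, x (Sum.inr j) ≠ 0 := fun j => by linarith [xj j]
  have xj1 : ∀ j, x (Sum.inr j) ≠ 1 := fun j => by linarith [xj j]
  refine ⟨fun a => max (r a) 0 / T, fun a => max (-r a) 0 / T, fun a => by positivity,
    fun a => by positivity, ?_, ?_, ?_, ?_, ?_, ?_, ?_⟩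
  · rw [← Finset.sum_div]; exact div_self hTp.ne'
  · rw [← Finset.sum_div, ← hT']; exact div_self hTp.ne'
  · intro c hc
    have h0 := sum_signedWeight_mul_pow hc
    have h1 := congrArg (· / T) h0
    simp only [zero_div, Finset.sum_div] at h1
    rw [← sub_eq_zero, ← Finset.sum_sub_distrib]
    refine (Finset.sum_congr rfl fun a _ => ?_).trans h1
    rw [div_mul_eq_mul_div, div_mul_eq_mul_div, ← sub_div, ← sub_mul,
      max_zero_sub_max_neg_zero_eq_self]
  · have h1 := Finset.single_le_sum (f := fun a => max (-r a) 0 / T * x a)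
      (fun a _ => mul_nonneg (by positivity) (xnn a)) (Finset.mem_univ (Sum.inl 1))
    refine le_trans ?_ h1
    simp only [x1, w'1, mul_one]
    rw [le_div_iff₀ hTp, hT', Fintype.sum_sum_type, Fin.sum_univ_three, w'0, w'1, w'2]
    have h2 : ∑ j, max (-r (Sum.inr j)) 0 ≤ 6 / 10 ^ 9 := by
      refine le_trans (Finset.sum_le_sum fun j _ => ?_) (tail' 0 (by positivity))
      simpa using neg_le_abs (r (Sum.inr j))
    linarith
  · intro θ h0 hθ
    rw [← hx, Fintype.sum_sum_type, Fin.sum_univ_three]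
    simp only [x0, x1, x2, xj0, w1, w2, if_true, if_false, one_ne_zero, zero_div, zero_mul]
    have h1 := tail' θ hθ
    have h2 : ∑ j, max (r (Sum.inr j)) 0 / T * Real.exp (θ * x (Sum.inr j)) ≤ 6 / 10 ^ 9 :=
      le_trans (Finset.sum_le_sum fun j _ =>
        mul_le_mul_of_nonneg_right (hwle _) (Real.exp_pos _).le) h1
    have h3 : Real.exp (θ * 1000) ≤ 1001 / 1000 :=
      exp_le_of_small (by linarith [hsmall θ hθ])
    have h4 := mul_le_mul ((hle _ r2'.le).trans r2''.le) h3 (Real.exp_pos _).le (by norm_num)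
    norm_num at *
    linarith
  · intro θ h0 hθ
    rw [← hx, Fintype.sum_sum_type, Fin.sum_univ_three]
    simp only [x0, x1, x2, xj1, w'0, w'2, if_true, if_false, zero_div, zero_mul]
    have h1 := tail' θ hθ
    have h2 : ∑ j, max (-r (Sum.inr j)) 0 / T * Real.exp (θ * x (Sum.inr j)) ≤ 6 / 10 ^ 9 :=
      le_trans (Finset.sum_le_sum fun j _ =>
        mul_le_mul_of_nonneg_right (hwle' _) (Real.exp_pos _).le) h1
    norm_num at *
    linarith
  · intro θ h0 hθ
    rw [← hx, Fintype.sum_sum_type, Fin.sum_univ_three]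
    simp only [x0, x1, x2, w'0, w'1, w'2, zero_div, zero_mul, mul_one, zero_add, add_zero]
    have h2 : ∑ j, max (-r (Sum.inr j)) 0 / T * x (Sum.inr j) * Real.exp (θ * x (Sum.inr j)) ≤
        6 / 10 ^ 3 := by
      refine le_trans (Finset.sum_le_sum fun j _ => ?_) (tail θ hθ)
      rw [mul_right_comm]
      exact mul_le_mul_of_nonneg_right (mul_le_mul_of_nonneg_right (hwle' _) (Real.exp_pos _).le)
        (xnn _)
    have h3 : Real.exp θ ≤ 1001 / 1000 := exp_le_of_small (by linarith [hsmall θ hθ])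
    have h4 := mul_le_mul ((hle (-r (Sum.inl 1)) (by linarith)).trans
      (by linarith : -r (Sum.inl 1) ≤ 1002 / 1000)) h3 (Real.exp_pos _).le (by norm_num)
    norm_num at *
    linarith

/-! ### Independent families with a finite law -/

/-- The expectation of `F` over `N` independent draws from the finite law `w`. -/
def iidE {ι : Type*} [Fintype ι] {N : ℕ} (w : ι → ℝ) (F : (Fin N → ι) → ℝ) : ℝ :=
  ∑ ω, (∏ i, w (ω i)) * F ω

section iid
variable {ι : Type*} [Fintype ι] {N : ℕ} {w : ι → ℝ}

lemma iidE_mono (hw : ∀ a, 0 ≤ w a) {F G : (Fin N → ι) → ℝ} (h : ∀ ω, F ω ≤ G ω) :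
    iidE w F ≤ iidE w G :=
  Finset.sum_le_sum fun ω _ => mul_le_mul_of_nonneg_left (h ω) (Finset.prod_nonneg fun _ _ => hw _)

lemma iidE_nonneg (hw : ∀ a, 0 ≤ w a) {F : (Fin N → ι) → ℝ} (h : ∀ ω, 0 ≤ F ω) :
    0 ≤ iidE w F :=
  Finset.sum_nonneg fun ω _ => mul_nonneg (Finset.prod_nonneg fun _ _ => hw _) (h ω)

lemma iidE_add (F G : (Fin N → ι) → ℝ) :
    iidE w (fun ω => F ω + G ω) = iidE w F + iidE w G := by
  simp [iidE, mul_add, Finset.sum_add_distrib]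

lemma iidE_const_mul (c : ℝ) (F : (Fin N → ι) → ℝ) :
    iidE w (fun ω => c * F ω) = c * iidE w F := by
  simp only [iidE, Finset.mul_sum]
  exact Finset.sum_congr rfl fun ω _ => by ring

lemma iidE_sum {κ : Type*} (s : Finset κ) (F : κ → (Fin N → ι) → ℝ) :
    iidE w (fun ω => ∑ k ∈ s, F k ω) = ∑ k ∈ s, iidE w (F k) := by
  simp only [iidE, Finset.mul_sum]
  exact Finset.sum_comm

lemma iidE_prod (g : Fin N → ι → ℝ) :
    iidE w (fun ω => ∏ i, g i (ω i)) = ∏ i, ∑ a, w a * g i a := by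
  classical
  rw [Fintype.prod_sum]
  simp [iidE, Finset.prod_mul_distrib]

lemma iidE_const (hw : ∑ a, w a = 1) (c : ℝ) : iidE w (fun _ : Fin N → ι => c) = c := by
  have h := iidE_prod (N := N) (w := w) (fun _ _ => 1)
  simp only [mul_one, hw, Finset.prod_const_one] at h
  have h2 := iidE_const_mul (w := w) c (fun _ : Fin N → ι => 1)
  simp only [mul_one] at h2
  rw [h2, h, mul_one]

lemma iidE_sum_apply (hw : ∑ a, w a = 1) (x : ι → ℝ) :
    iidE w (fun ω : Fin N → ι => ∑ i, x (ω i)) = N * ∑ a, w a * x a := by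
  classical
  rw [iidE_sum]
  have h : ∀ i : Fin N, iidE w (fun ω => x (ω i)) = ∑ a, w a * x a := by
    intro i
    have := iidE_prod (w := w) (fun j a => if j = i then x a else (1 : ℝ))
    simp only [Finset.prod_ite_eq', Finset.mem_univ, if_true] at this
    rw [this, Finset.prod_eq_single i]
    · simp
    · intro j _ hj; simp [hj, hw]
    · simp
  simp [h]

/-- Grouping a sample by the points it hits leaves only moments of order equal to the
multiplicities. This is where matching moments enter. -/
lemma iidE_prod_comp (x : ι → ℝ) {m : ℕ} (xs : Fin m → Fin N) :
    iidE w (fun ω => ∏ k, x (ω (xs k))) =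
      ∏ i, ∑ a, w a * x a ^ (Finset.univ.filter fun k => xs k = i).card := by
  rw [← iidE_prod]
  congr 1
  ext ω
  rw [← Finset.prod_fiberwise Finset.univ xs]
  refine Finset.prod_congr rfl fun i _ => ?_
  rw [← Finset.prod_const]
  exact Finset.prod_congr rfl fun k hk => by rw [(Finset.mem_filter.mp hk).2]

/-- Chebyshev's association inequality: with `c` the mean of the sum `S`, the differences `S ^ (k +
l) - c ^ (k + l)` and `S - c` have the same sign. -/
lemma iidE_pow_mul_le (hw : ∀ a, 0 ≤ w a) (hw1 : ∑ a, w a = 1) {x : ι → ℝ} (hx : ∀ a, 0 ≤ x a)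
    (k l : ℕ) :
    iidE w (fun ω : Fin N → ι => (∑ i, x (ω i)) ^ k) * (N * ∑ a, w a * x a) ^ l ≤
      iidE w (fun ω : Fin N → ι => (∑ i, x (ω i)) ^ (k + l)) := by
  induction l with
  | zero => simp
  | succ l ih =>
    set c := N * ∑ a, w a * x a with hc
    have hc0 : 0 ≤ c := mul_nonneg (by positivity)
      (Finset.sum_nonneg fun a _ => mul_nonneg (hw a) (hx a))
    have h : 0 ≤ iidE w (fun ω : Fin N → ι =>
        ((∑ i, x (ω i)) ^ (k + l) - c ^ (k + l)) * (∑ i, x (ω i) - c)) := by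
      refine iidE_nonneg hw fun ω => ?_
      have hS : 0 ≤ ∑ i, x (ω i) := Finset.sum_nonneg fun i _ => hx _
      rcases le_total c (∑ i, x (ω i)) with h | h
      · exact mul_nonneg (sub_nonneg.mpr (pow_le_pow_left₀ hc0 h _)) (sub_nonneg.mpr h)
      · exact mul_nonneg_of_nonpos_of_nonpos (sub_nonpos.mpr (pow_le_pow_left₀ hS h _))
          (sub_nonpos.mpr h)
    have e : iidE w (fun ω : Fin N → ι =>
        ((∑ i, x (ω i)) ^ (k + l) - c ^ (k + l)) * (∑ i, x (ω i) - c)) =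
        iidE w (fun ω : Fin N → ι => (∑ i, x (ω i)) ^ (k + (l + 1))) +
        ((-c) * iidE w (fun ω : Fin N → ι => (∑ i, x (ω i)) ^ (k + l)) +
        ((-c ^ (k + l)) * iidE w (fun ω : Fin N → ι => ∑ i, x (ω i)) +
          iidE w (fun _ : Fin N → ι => c ^ (k + l) * c))) := by
      rw [← iidE_const_mul, ← iidE_const_mul, ← iidE_add, ← iidE_add, ← iidE_add]
      congr 1
      ext ω
      ring
    rw [e, iidE_sum_apply hw1, iidE_const hw1] at h
    have := mul_le_mul_of_nonneg_right ih hc0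
    rw [pow_succ, ← mul_assoc]
    linarith

/-- A Chernoff bound under the weight `S ^ m`. From `t ≤ exp (t - 1)` with `t = S / (N * μ)`, the
weight is at most `(N * μ) ^ m * exp (θ * S - m)` for `θ = m / (N * μ)`, which factorises over the
coordinates. -/
lemma iidE_pow_mul_indicator_le (hw : ∀ a, 0 ≤ w a) {x : ι → ℝ} (hx : ∀ a, 0 ≤ x a)
    {μ : ℝ} (hμ : 0 < μ) (hN : 0 < N) (m : ℕ) {g : ι → ℝ} {B : Set (Fin N → ι)}
    (hB : ∀ ω, B.indicator 1 ω ≤ ∏ i, g (ω i)) :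
    iidE w (fun ω : Fin N → ι => (∑ i, x (ω i)) ^ m * B.indicator 1 ω) ≤
      (N * μ) ^ m * (Real.exp (-(m / (N * μ) * μ)) *
        ∑ a, w a * (Real.exp (m / (N * μ) * x a) * g a)) ^ N := by
  have hN' : (0 : ℝ) < N := by exact_mod_cast hN
  set θ := m / (N * μ) with hθ
  have hθc : θ * (N * μ) = m := div_mul_cancel₀ _ (by positivity)
  have h := iidE_prod (N := N) (w := w) (fun _ a => Real.exp (θ * x a) * g a)
  rw [Finset.prod_const, Finset.card_univ, Fintype.card_fin] at h
  rw [mul_pow (Real.exp _), ← h, ← mul_assoc, ← iidE_const_mul]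
  refine iidE_mono hw fun ω => ?_
  rw [Finset.prod_mul_distrib, ← mul_assoc]
  have hS : 0 ≤ ∑ i, x (ω i) := Finset.sum_nonneg fun i _ => hx _
  refine mul_le_mul ?_ (hB ω) (Set.indicator_nonneg (fun _ _ => zero_le_one) _) (by positivity)
  rw [← Real.exp_sum, ← Finset.mul_sum, ← Real.exp_nat_mul, mul_assoc, ← Real.exp_add]
  have h1 : ∑ i, x (ω i) ≤ N * μ * Real.exp ((∑ i, x (ω i)) / (N * μ) - 1) := by
    have := Real.add_one_le_exp ((∑ i, x (ω i)) / (N * μ) - 1)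
    rw [sub_add_cancel, div_le_iff₀ (by positivity)] at this
    linarith
  refine (pow_le_pow_left₀ hS h1 m).trans (le_of_eq ?_)
  rw [mul_pow, ← Real.exp_nat_mul]
  congr 2
  rw [mul_sub, mul_one, ← hθc]
  field_simp
  ring

end iid

lemma sum_biUnion_le_sum {α β : Type*} [DecidableEq β] {s : Finset α} {t : α → Finset β}
    {f : β → ℝ} (hf : ∀ b, 0 ≤ f b) : ∑ b ∈ s.biUnion t, f b ≤ ∑ a ∈ s, ∑ b ∈ t a, f b := by
  classical
  induction s using Finset.induction_on with
  | empty => simp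
  | insert a s ha ih =>
    rw [Finset.biUnion_insert, Finset.sum_insert ha]
    have := Finset.sum_union_inter (s₁ := t a) (s₂ := s.biUnion t) (f := f)
    have h0 : 0 ≤ ∑ b ∈ t a ∩ s.biUnion t, f b := Finset.sum_nonneg fun b _ => hf b
    linarith

/-- Union bound over the sets of `L` positions that all hold `i`; for a fixed set the sum
factorises. -/
lemma sum_prod_count_ge_le {N m : ℕ} (a : Fin N → ℝ) (ha : ∀ i, 0 ≤ a i) (i : Fin N) (L : ℕ) :
    ∑ xs : Fin m → Fin N with L ≤ (Finset.univ.filter fun k => xs k = i).card, ∏ k, a (xs k) ≤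
      m.choose L * (a i ^ L * (∑ j, a j) ^ (m - L)) := by
  classical
  have hT : ∀ T ∈ Finset.powersetCard L (Finset.univ : Finset (Fin m)),
      ∑ xs ∈ Fintype.piFinset (fun k => if k ∈ T then {i} else (Finset.univ : Finset (Fin N))),
        ∏ k, a (xs k) = a i ^ L * (∑ j, a j) ^ (m - L) := by
    intro T hT
    have hc := (Finset.mem_powersetCard.mp hT).2
    rw [← Finset.prod_univ_sum (fun k => if k ∈ T then {i} else (Finset.univ : Finset (Fin N)))
      (fun _ j => a j)]
    have : ∀ k, ∑ j ∈ (if k ∈ T then {i} else (Finset.univ : Finset (Fin N))), a j =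
        if k ∈ T then a i else ∑ j, a j := by
      intro k; split_ifs <;> simp
    simp only [this]
    rw [Finset.prod_ite]
    simp only [Finset.prod_const]
    congr 2
    · simp [hc]
    · rw [Finset.filter_not, Finset.card_sdiff_of_subset (Finset.filter_subset _ _)]
      simp [hc]
  calc _ ≤ ∑ xs ∈ (Finset.powersetCard L (Finset.univ : Finset (Fin m))).biUnion (fun T =>
          Fintype.piFinset (fun k => if k ∈ T then {i} else (Finset.univ : Finset (Fin N)))),
          ∏ k, a (xs k) := by
        refine Finset.sum_le_sum_of_subset_of_nonneg ?_
          fun xs _ _ => Finset.prod_nonneg fun k _ => ha _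
        intro xs hxs
        obtain ⟨T, hT1, hT2⟩ := Finset.exists_subset_card_eq (Finset.mem_filter.mp hxs).2
        refine Finset.mem_biUnion.mpr ⟨T, Finset.mem_powersetCard.mpr
          ⟨Finset.subset_univ _, hT2⟩, Fintype.mem_piFinset.mpr fun k => ?_⟩
        split_ifs with hk
        · simpa using hT1 hk
        · simp
    _ ≤ ∑ T ∈ Finset.powersetCard L (Finset.univ : Finset (Fin m)),
          ∑ xs ∈ Fintype.piFinset
            (fun k => if k ∈ T then {i} else (Finset.univ : Finset (Fin N))), ∏ k, a (xs k) :=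
        sum_biUnion_le_sum fun xs => Finset.prod_nonneg fun k _ => ha _
    _ = _ := by
        rw [Finset.sum_congr rfl hT, Finset.sum_const, Finset.card_powersetCard, nsmul_eq_mul]
        simp

/-! ### The sample complexity of deciding small support -/

-- Each sample with an `L`-fold repetition gives up a factor at most `X ^ L` and leaves `S ^ (m -
-- L)`, which `iidE_pow_mul_le` trades for `S ^ m / (N * μ) ^ L`.
open Classical in
lemma iidE_sum_heavy_le {ι : Type*} [Fintype ι] {N m : ℕ} {w x : ι → ℝ} (hw : ∀ a, 0 ≤ w a)
    (hw1 : ∑ a, w a = 1) (hx : ∀ a, 0 ≤ x a) {X : ℝ} (hX : ∀ a, x a ≤ X) (hN : 0 < N)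
    (hμ : 0 < ∑ a, w a * x a) (L : ℕ) :
    ∑ xs : Fin m → Fin N with ∃ i, L ≤ (Finset.univ.filter fun k => xs k = i).card,
      iidE w (fun ω => ∏ k, x (ω (xs k))) ≤
    N * (m.choose L * (X / (N * ∑ a, w a * x a)) ^ L) *
      iidE w (fun ω : Fin N → ι => (∑ i, x (ω i)) ^ m) := by
  have hN' : (0 : ℝ) < N := by exact_mod_cast hN
  set μ := ∑ a, w a * x a with hμdef
  have hX0 : 0 ≤ X := by
    obtain ⟨a⟩ : Nonempty ι := by
      by_contra h
      rw [not_nonempty_iff] at h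
      simp at hw1
    exact (hx a).trans (hX a)
  rw [← iidE_sum]
  have h1 : iidE w (fun ω : Fin N → ι =>
      ∑ xs : Fin m → Fin N with ∃ i, L ≤ (Finset.univ.filter fun k => xs k = i).card,
        ∏ k, x (ω (xs k))) ≤
      iidE w (fun ω : Fin N → ι => (N * (m.choose L * X ^ L)) * (∑ i, x (ω i)) ^ (m - L)) := by
    refine iidE_mono hw fun ω => ?_
    have hS : 0 ≤ ∑ i, x (ω i) := Finset.sum_nonneg fun i _ => hx _
    calc _ ≤ ∑ xs ∈ (Finset.univ : Finset (Fin N)).biUnion (fun i => Finset.univ.filter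
            fun xs : Fin m → Fin N => L ≤ (Finset.univ.filter fun k => xs k = i).card),
            ∏ k, x (ω (xs k)) := by
          refine Finset.sum_le_sum_of_subset_of_nonneg ?_
            fun xs _ _ => Finset.prod_nonneg fun k _ => hx _
          intro xs hxs
          simpa using hxs
      _ ≤ ∑ i : Fin N, ∑ xs : Fin m → Fin N with
            L ≤ (Finset.univ.filter fun k => xs k = i).card, ∏ k, x (ω (xs k)) :=
          sum_biUnion_le_sum fun xs => Finset.prod_nonneg fun k _ => hx _
      _ ≤ ∑ _i : Fin N, (m.choose L * X ^ L) * (∑ i, x (ω i)) ^ (m - L) := by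
          refine Finset.sum_le_sum fun i _ => ?_
          refine (sum_prod_count_ge_le (fun j => x (ω j)) (fun _ => hx _) i L).trans ?_
          rw [mul_assoc]
          gcongr
          · exact hx _
          · exact hX _
      _ = _ := by simp; ring
  refine h1.trans ?_
  rw [iidE_const_mul]
  rcases lt_or_ge m L with hmL | hmL
  · rw [Nat.choose_eq_zero_of_lt hmL]; simp
  have h2 := iidE_pow_mul_le (N := N) hw hw1 hx (m - L) L
  rw [Nat.sub_add_cancel hmL] at h2
  rw [div_pow, ← hμdef] at *
  have hp : 0 < (N * μ) ^ L := by positivity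
  calc _ = N * (m.choose L * (X ^ L / (N * μ) ^ L)) *
        (iidE w (fun ω : Fin N → ι => (∑ i, x (ω i)) ^ (m - L)) * (N * μ) ^ L) := by
        field_simp
    _ ≤ _ := by gcongr

lemma choose_mul_pow_le {m L : ℕ} (hL : 0 < L) {t : ℝ} (ht : 0 ≤ t)
    (h : 3 * m * t / L ≤ Real.exp (-1)) : m.choose L * t ^ L ≤ Real.exp (-(L : ℝ)) := by
  have hL' : (0 : ℝ) < L := by exact_mod_cast hL
  have h1 : (m.choose L : ℝ) ≤ m ^ L / L.factorial := Nat.choose_le_pow_div L m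
  have h2 := Real.pow_div_factorial_le_exp (L : ℝ) hL'.le L
  have h3 : Real.exp (L : ℝ) ≤ 3 ^ L := by
    have : Real.exp (L : ℝ) = Real.exp 1 ^ L := by rw [← Real.exp_nat_mul, mul_one]
    rw [this]
    exact pow_le_pow_left₀ (Real.exp_pos _).le (by linarith [Real.exp_one_lt_d9]) _
  have hf : (0 : ℝ) < L.factorial := by exact_mod_cast L.factorial_pos
  have h4 : (1 : ℝ) / L.factorial ≤ 3 ^ L / L ^ L := by
    rw [div_le_iff₀ hf] at h2
    rw [div_le_div_iff₀ hf (by positivity)]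
    nlinarith
  calc (m.choose L : ℝ) * t ^ L ≤ m ^ L / L.factorial * t ^ L := by gcongr
    _ = m ^ L * t ^ L * (1 / L.factorial) := by ring
    _ ≤ m ^ L * t ^ L * (3 ^ L / L ^ L) := by gcongr
    _ = (3 * m * t / L) ^ L := by rw [div_pow, mul_pow, mul_pow]; ring
    _ ≤ Real.exp (-1) ^ L := pow_le_pow_left₀ (by positivity) h _
    _ = _ := by rw [← Real.exp_nat_mul]; congr 1; ring

lemma matchPt_nonneg {M : ℕ} (a : Fin 3 ⊕ Fin M) : 0 ≤ matchPt M a := by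
  rcases a with i | j
  · fin_cases i <;> simp [matchPt]
  · simp only [matchPt, Sum.elim_inr]; positivity

lemma matchPt_le {M : ℕ} (hM : 0 < M) (a : Fin 3 ⊕ Fin M) : matchPt M a ≤ 10 ^ 6 * M ^ 2 := by
  have hM' : (1 : ℝ) ≤ M := by exact_mod_cast hM
  have h1 : (1 : ℝ) ≤ M ^ 2 := one_le_pow₀ hM'
  rcases a with i | j
  · have : matchPt M (Sum.inl i) ≤ 1000 := by fin_cases i <;> simp [matchPt]
    nlinarith
  · simp only [matchPt, Sum.elim_inr]
    have : (j : ℝ) + 1 ≤ M := by exact_mod_cast j.2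
    gcongr

/-- If `m` is small, the samples of a random measure built from either law look alike. -/
lemma matching_transfer {M N m : ℕ} {w w' : Fin 3 ⊕ Fin M → ℝ} (h : MatchingLaws M w w')
    (hM : 0 < M) (hN : 0 < N) (hNM : (N : ℝ) * Real.exp (-(M : ℝ)) ≤ 1 / 100)
    (hm : m / (N * ∑ a, w' a * matchPt M a) ≤ 1 / (10 ^ 7 * M))
    {G : (Fin m → Fin N) → ℝ} (hG0 : ∀ xs, 0 ≤ G xs) (hG1 : ∀ xs, G xs ≤ 1) :
    (∑ xs, iidE w (fun ω => ∏ k, matchPt M (ω (xs k))) * G xs ≤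
      ∑ xs, iidE w' (fun ω => ∏ k, matchPt M (ω (xs k))) * G xs +
        1 / 100 * iidE w (fun ω : Fin N → _ => (∑ i, matchPt M (ω i)) ^ m)) ∧
    (iidE w' (fun ω : Fin N → _ => (∑ i, matchPt M (ω i)) ^ m) ≤
      iidE w (fun ω : Fin N → _ => (∑ i, matchPt M (ω i)) ^ m) +
        1 / 100 * iidE w' (fun ω : Fin N → _ => (∑ i, matchPt M (ω i)) ^ m)) := by
  classical
  have hM' : (0 : ℝ) < M := by exact_mod_cast hM
  have hN' : (0 : ℝ) < N := by exact_mod_cast hN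
  set x := matchPt M with hx
  have hmean : ∑ a, w a * x a = ∑ a, w' a * x a := by simpa using h.moment_eq 1 hM
  have hμ : 0 < ∑ a, w' a * x a := by linarith [h.mean_ge]
  set μ := ∑ a, w' a * x a with hμdef
  set P := fun (v : Fin 3 ⊕ Fin M → ℝ) (xs : Fin m → Fin N) =>
    iidE v (fun ω => ∏ k, x (ω (xs k))) with hP
  set Bad := Finset.univ.filter fun xs : Fin m → Fin N =>
    ∃ i, M + 1 ≤ (Finset.univ.filter fun k => xs k = i).card with hBad
  -- The largest node is `10 ^ 6 * M ^ 2`. With `m / (N * μ) ≤ 1 / (10 ^ 7 * M)` the base in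
  -- `choose_mul_pow_le` is at most `3 / 10`, below `1 / e`, and `exp (-(M + 1))` beats the factor
  -- `N`.
  have hsmall : (N : ℝ) * (m.choose (M + 1) * (10 ^ 6 * M ^ 2 / (N * μ)) ^ (M + 1)) ≤ 1 / 100 := by
    have h1 : (m.choose (M + 1) : ℝ) * (10 ^ 6 * M ^ 2 / (N * μ)) ^ (M + 1) ≤
        Real.exp (-((M + 1 : ℕ) : ℝ)) := by
      refine choose_mul_pow_le (Nat.succ_pos _) (by positivity) ?_
      have e : 3 * (m : ℝ) * (10 ^ 6 * M ^ 2 / (N * μ)) / ((M + 1 : ℕ) : ℝ) =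
          3 * 10 ^ 6 * M ^ 2 * (m / (N * μ)) / (M + 1) := by push_cast; ring
      rw [e]
      have h2 : 3 * 10 ^ 6 * (M : ℝ) ^ 2 * (m / (N * μ)) / (M + 1) ≤ 3 / 10 := by
        rw [div_le_iff₀ (by positivity)]
        calc 3 * 10 ^ 6 * (M : ℝ) ^ 2 * (m / (N * μ)) ≤
            3 * 10 ^ 6 * (M : ℝ) ^ 2 * (1 / (10 ^ 7 * (M : ℝ))) := by gcongr
          _ = 3 / 10 * (M : ℝ) := by field_simp
          _ ≤ 3 / 10 * ((M : ℝ) + 1) := by linarith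
      have h3 : (1 : ℝ) / 3 ≤ Real.exp (-1) := by
        rw [Real.exp_neg, ← one_div]
        exact one_div_le_one_div_of_le (Real.exp_pos _) (by linarith [Real.exp_one_lt_d9])
      linarith
    calc _ ≤ (N : ℝ) * Real.exp (-((M + 1 : ℕ) : ℝ)) := by gcongr
      _ ≤ N * Real.exp (-(M : ℝ)) := by gcongr; linarith
      _ ≤ _ := hNM
  have hsum : ∀ v : Fin 3 ⊕ Fin M → ℝ,
      ∑ xs, P v xs = iidE v (fun ω : Fin N → _ => (∑ i, x (ω i)) ^ m) := by
    intro v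
    rw [hP, ← iidE_sum]
    simp only [Fintype.sum_pow]
  have hPnn : ∀ v : Fin 3 ⊕ Fin M → ℝ, (∀ a, 0 ≤ v a) → ∀ xs, 0 ≤ P v xs := fun v hv xs =>
    iidE_nonneg hv fun ω => Finset.prod_nonneg fun k _ => matchPt_nonneg _
  have hbad : ∀ v : Fin 3 ⊕ Fin M → ℝ, (∀ a, 0 ≤ v a) → ∑ a, v a = 1 → ∑ a, v a * x a = μ →
      ∑ xs ∈ Bad, P v xs ≤ 1 / 100 * iidE v (fun ω : Fin N → _ => (∑ i, x (ω i)) ^ m) := by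
    intro v hv hv1 hvμ
    refine (iidE_sum_heavy_le hv hv1 matchPt_nonneg (matchPt_le hM) hN (by rw [hvμ]; exact hμ)
      (M + 1)).trans ?_
    rw [hvμ]
    exact mul_le_mul_of_nonneg_right hsmall (iidE_nonneg hv fun ω =>
      pow_nonneg (Finset.sum_nonneg fun i _ => matchPt_nonneg _) _)
  -- Off `Bad` all multiplicities are at most `M`, so only matched moments occur.
  have heq : ∀ xs ∉ Bad, P w xs = P w' xs := by
    intro xs hxs
    simp only [hBad, Finset.mem_filter, Finset.mem_univ, true_and, not_exists, not_le] at hxs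
    simp only [hP, iidE_prod_comp]
    exact Finset.prod_congr rfl fun i _ => h.moment_eq _ (Nat.lt_succ_iff.mp (hxs i))
  have hcmp : ∀ (v v' : Fin 3 ⊕ Fin M → ℝ), (∀ a, 0 ≤ v a) → (∀ a, 0 ≤ v' a) →
      (∀ xs ∉ Bad, P v xs = P v' xs) → ∀ H : (Fin m → Fin N) → ℝ, (∀ xs, 0 ≤ H xs) →
      (∀ xs, H xs ≤ 1) → ∑ xs, P v xs * H xs ≤ ∑ xs, P v' xs * H xs + ∑ xs ∈ Bad, P v xs := by
    intro v v' hv hv' he H hH0 hH1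
    rw [← Finset.sum_filter_add_sum_filter_not Finset.univ (· ∈ Bad) (fun xs => P v xs * H xs),
      ← Finset.sum_filter_add_sum_filter_not Finset.univ (· ∈ Bad) (fun xs => P v' xs * H xs)]
    have e1 : ∑ xs with xs ∉ Bad, P v xs * H xs = ∑ xs with xs ∉ Bad, P v' xs * H xs :=
      Finset.sum_congr rfl fun xs hxs => by rw [he xs (Finset.mem_filter.mp hxs).2]
    have e2 : ∑ xs with xs ∈ Bad, P v xs * H xs ≤ ∑ xs ∈ Bad, P v xs := by
      simp only [Finset.filter_mem_eq_inter, Finset.univ_inter]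
      exact Finset.sum_le_sum fun xs _ => mul_le_of_le_one_right (hPnn v hv xs) (hH1 xs)
    have e3 : 0 ≤ ∑ xs with xs ∈ Bad, P v' xs * H xs :=
      Finset.sum_nonneg fun xs _ => mul_nonneg (hPnn v' hv' xs) (hH0 xs)
    linarith
  refine ⟨?_, ?_⟩
  · exact (hcmp w w' h.nonneg h.nonneg' heq G hG0 hG1).trans
      (add_le_add_right (hbad w h.nonneg h.sum_eq_one hmean) _)
  · have := (hcmp w' w h.nonneg' h.nonneg (fun xs hxs => (heq xs hxs).symm) (fun _ => 1)
      (fun _ => zero_le_one) fun _ => le_rfl).trans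
      (add_le_add_right (hbad w' h.nonneg' h.sum_eq_one' rfl) _)
    simpa only [mul_one, hsum] using this

lemma one_div_ten_pow_mul_le (M : ℕ) : 1 / (10 ^ 7 * (M : ℝ)) ≤ 1 / (2 * 10 ^ 6 * M) := by
  rw [← div_div, ← div_div]
  gcongr
  norm_num

/-! ### Tail bounds for atypical random weights, under the weight `S ^ m`. -/

section bad
variable {M d m : ℕ} {w w' : Fin 3 ⊕ Fin M → ℝ}

lemma exp_prod_card {N : ℕ} {ι : Type*} (p : ι → Prop) [DecidablePred p] (c : ℝ) (ω : Fin N → ι) :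
    ∏ i, Real.exp ((if p (ω i) then 1 else 0) - c) =
      Real.exp ((Finset.univ.filter fun i => p (ω i)).card - N * c) := by
  rw [← Real.exp_sum, Finset.sum_sub_distrib]
  simp

lemma indicator_le_of_forall_mem {α : Type*} {B : Set α} {g : α → ℝ} (h0 : ∀ ω, 0 ≤ g ω)
    (h1 : ∀ ω ∈ B, 1 ≤ g ω) (ω : α) : B.indicator 1 ω ≤ g ω := by
  by_cases h : ω ∈ B
  · simpa [h] using h1 ω h
  · simpa [h] using h0 ω

/-- A coordinate is nonzero with tilted mass at most `0.0015`, far below the threshold `1 / 100`.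
Each of the `100 * d` coordinates contributes at most `exp (-1 / 100) * (1 + 0.0045) ≤ exp (-1 /
200)`. -/
lemma large_support_le (h : MatchingLaws M w w') (hd : 0 < d) {μ : ℝ} (hμ : 0 < μ)
    (hm : m / ((100 * d : ℕ) * μ) ≤ 1 / (10 ^ 7 * M)) :
    iidE w (fun ω : Fin (100 * d) → _ => (∑ i, matchPt M (ω i)) ^ m *
      {ω | d < (Finset.univ.filter fun i => matchPt M (ω i) ≠ 0).card}.indicator 1 ω) ≤
    ((100 * d : ℕ) * μ) ^ m * Real.exp (-((d : ℝ) / 2)) := by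
  classical
  set θ := m / ((100 * d : ℕ) * μ) with hθ
  have hθ0 : 0 ≤ θ := by positivity
  have hd' : (0 : ℝ) < d := by exact_mod_cast hd
  refine (iidE_pow_mul_indicator_le h.nonneg matchPt_nonneg hμ (by omega) m
    (g := fun a => Real.exp ((if matchPt M a ≠ 0 then 1 else 0) - 1 / 100)) ?_).trans ?_
  · refine indicator_le_of_forall_mem (fun ω => by positivity) fun ω hω => ?_
    rw [exp_prod_card (fun a => matchPt M a ≠ 0), Real.one_le_exp_iff]
    have : (d : ℝ) < ((Finset.univ.filter fun i => matchPt M (ω i) ≠ 0).card : ℝ) := by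
      exact_mod_cast hω
    push_cast
    linarith
  · rw [← hθ]
    refine mul_le_mul_of_nonneg_left ?_ (by positivity)
    have h1 : ∑ a, w a * (Real.exp (θ * matchPt M a) *
        Real.exp ((if matchPt M a ≠ 0 then 1 else 0) - 1 / 100)) ≤ Real.exp (-(1 / 200)) := by
      have h2 : ∀ a, w a * (Real.exp (θ * matchPt M a) *
        Real.exp ((if matchPt M a ≠ 0 then 1 else 0) - 1 / 100)) ≤ Real.exp (-(1 / 100)) *
          (w a + 3 * (if matchPt M a = 0 then 0 else w a * Real.exp (θ * matchPt M a))) := by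
        intro a
        have hwa := h.nonneg a
        by_cases ha : matchPt M a = 0
        · simp [ha, mul_comm]
        · simp only [ha, ne_eq, not_false_eq_true, if_true, if_false]
          rw [sub_eq_add_neg, Real.exp_add]
          have := Real.exp_one_lt_d9
          have e : 0 ≤ w a * Real.exp (θ * matchPt M a) := by positivity
          have e2 := Real.exp_pos (-(1 / 100))
          calc _ = Real.exp (-(1 / 100)) * (Real.exp 1 * (w a * Real.exp (θ * matchPt M a))) := by
                ring
            _ ≤ Real.exp (-(1 / 100)) * (3 * (w a * Real.exp (θ * matchPt M a))) := by
                gcongr; linarith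
            _ ≤ _ := by gcongr; linarith
      refine (Finset.sum_le_sum fun a _ => h2 a).trans ?_
      rw [← Finset.mul_sum, Finset.sum_add_distrib, h.sum_eq_one, ← Finset.mul_sum]
      have h3 := h.exp_ne_zero_le θ hθ0 (hm.trans (one_div_ten_pow_mul_le M))
      have h4 := Real.add_one_le_exp (1 / 200 : ℝ)
      calc _ ≤ Real.exp (-(1 / 100)) * Real.exp (1 / 200) := by gcongr; linarith
        _ = _ := by rw [← Real.exp_add]; norm_num
    calc _ ≤ (1 * Real.exp (-(1 / 200))) ^ (100 * d) := by
          have : Real.exp (-(θ * μ)) ≤ 1 := by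
            rw [Real.exp_le_one_iff, neg_nonpos]; positivity
          have h0 : 0 ≤ ∑ a, w a * (Real.exp (θ * matchPt M a) *
              Real.exp ((if matchPt M a ≠ 0 then 1 else 0) - 1 / 100)) :=
            Finset.sum_nonneg fun a _ => mul_nonneg (h.nonneg a) (by positivity)
          gcongr
      _ = _ := by
          rw [one_mul, ← Real.exp_nat_mul]; congr 1; push_cast; ring

lemma few_ones_le (h : MatchingLaws M w w') (hM : 0 < M) (hd : 0 < d) {μ : ℝ} (hμ : 0 < μ)
    (hm : m / ((100 * d : ℕ) * μ) ≤ 1 / (10 ^ 7 * M)) :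
    iidE w' (fun ω : Fin (100 * d) → _ => (∑ i, matchPt M (ω i)) ^ m *
      {ω | 10 * d < (Finset.univ.filter fun i => matchPt M (ω i) ≠ 1).card}.indicator 1 ω) ≤
    ((100 * d : ℕ) * μ) ^ m * Real.exp (-((d : ℝ) / 2)) := by
  classical
  set θ := m / ((100 * d : ℕ) * μ) with hθ
  have hθ0 : 0 ≤ θ := by positivity
  have hd' : (0 : ℝ) < d := by exact_mod_cast hd
  refine (iidE_pow_mul_indicator_le h.nonneg' matchPt_nonneg hμ (by omega) m
    (g := fun a => Real.exp ((if matchPt M a ≠ 1 then 1 else 0) - 1 / 10)) ?_).trans ?_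
  · refine indicator_le_of_forall_mem (fun ω => by positivity) fun ω hω => ?_
    rw [exp_prod_card (fun a => matchPt M a ≠ 1), Real.one_le_exp_iff]
    have : (10 * d : ℝ) < ((Finset.univ.filter fun i => matchPt M (ω i) ≠ 1).card : ℝ) := by
      exact_mod_cast hω
    push_cast
    linarith
  · rw [← hθ]
    refine mul_le_mul_of_nonneg_left ?_ (by positivity)
    have hθ1 : Real.exp θ ≤ 1001 / 1000 := by
      refine exp_le_of_small (hm.trans ?_)
      have hM' : (1 : ℝ) ≤ M := by exact_mod_cast hM
      rw [div_le_div_iff₀ (by positivity) (by norm_num)]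
      linarith
    have h1 : ∑ a, w' a * (Real.exp (θ * matchPt M a) *
        Real.exp ((if matchPt M a ≠ 1 then 1 else 0) - 1 / 10)) ≤ Real.exp (-(1 / 200)) := by
      have h2 : ∀ a, w' a * (Real.exp (θ * matchPt M a) *
        Real.exp ((if matchPt M a ≠ 1 then 1 else 0) - 1 / 10)) ≤ Real.exp (-(1 / 10)) *
          (w' a * Real.exp θ +
            3 * (if matchPt M a = 1 then 0 else w' a * Real.exp (θ * matchPt M a))) := by
        intro a
        have hwa := h.nonneg' a
        by_cases ha : matchPt M a = 1
        · simp only [ha, ne_eq, not_true_eq_false, if_true, if_false, mul_one, zero_sub]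
          exact le_of_eq (by ring)
        · simp only [ha, ne_eq, not_false_eq_true, if_true, if_false]
          rw [sub_eq_add_neg, Real.exp_add]
          have := Real.exp_one_lt_d9
          have e : 0 ≤ w' a * Real.exp (θ * matchPt M a) := by positivity
          have e2 := Real.exp_pos (-(1 / 10))
          have e3 : 0 ≤ w' a * Real.exp θ := by positivity
          calc _ = Real.exp (-(1 / 10)) * (Real.exp 1 * (w' a * Real.exp (θ * matchPt M a))) := by
                ring
            _ ≤ Real.exp (-(1 / 10)) * (3 * (w' a * Real.exp (θ * matchPt M a))) := by
                gcongr; linarith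
            _ ≤ _ := by gcongr; linarith
      refine (Finset.sum_le_sum fun a _ => h2 a).trans ?_
      rw [← Finset.mul_sum, Finset.sum_add_distrib, ← Finset.sum_mul, h.sum_eq_one',
        ← Finset.mul_sum]
      have h3 := h.exp_ne_one_le θ hθ0 (hm.trans (one_div_ten_pow_mul_le M))
      have h4 := Real.add_one_le_exp (1 / 10 - 1 / 200 : ℝ)
      calc _ ≤ Real.exp (-(1 / 10)) * Real.exp (1 / 10 - 1 / 200) := by gcongr; linarith
        _ = _ := by rw [← Real.exp_add]; norm_num
    calc _ ≤ (1 * Real.exp (-(1 / 200))) ^ (100 * d) := by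
          have : Real.exp (-(θ * μ)) ≤ 1 := by
            rw [Real.exp_le_one_iff, neg_nonpos]; positivity
          have h0 : 0 ≤ ∑ a, w' a * (Real.exp (θ * matchPt M a) *
              Real.exp ((if matchPt M a ≠ 1 then 1 else 0) - 1 / 10)) :=
            Finset.sum_nonneg fun a _ => mul_nonneg (h.nonneg' a) (by positivity)
          gcongr
      _ = _ := by
          rw [one_mul, ← Real.exp_nat_mul]; congr 1; push_cast; ring

/-- The extra tilt `η` is only of order `1 / M`, so that `θ + η` stays in the range where
exponential moments are controlled. The exponent per coordinate is at most `-θμ - 3η + 1.01 (θ + η)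
≤ -η`, since `μ ≥ 0.9` and `θ ≤ η`. -/
lemma large_sum_le (h : MatchingLaws M w w') (hM : 0 < M) (hd : 0 < d) {μ : ℝ}
    (hμ : 9 / 10 ≤ μ) (hm : m / ((100 * d : ℕ) * μ) ≤ 1 / (10 ^ 7 * M)) :
    iidE w' (fun ω : Fin (100 * d) → _ => (∑ i, matchPt M (ω i)) ^ m *
      {ω | 300 * (d : ℝ) < ∑ i, matchPt M (ω i)}.indicator 1 ω) ≤
    ((100 * d : ℕ) * μ) ^ m * Real.exp (-(d / (10 ^ 5 * M))) := by
  classical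
  have hμ0 : 0 < μ := by linarith
  have hM' : (1 : ℝ) ≤ M := by exact_mod_cast hM
  set θ := m / ((100 * d : ℕ) * μ) with hθ
  have hθ0 : 0 ≤ θ := by positivity
  have hd' : (0 : ℝ) < d := by exact_mod_cast hd
  set η := 1 / (10 ^ 7 * (M : ℝ)) with hη
  have hη0 : 0 < η := by positivity
  refine (iidE_pow_mul_indicator_le h.nonneg' matchPt_nonneg hμ0 (by omega) m
    (g := fun a => Real.exp (η * (matchPt M a - 3))) ?_).trans ?_
  · refine indicator_le_of_forall_mem (fun ω => by positivity) fun ω hω => ?_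
    rw [← Real.exp_sum, Real.one_le_exp_iff, ← Finset.mul_sum, Finset.sum_sub_distrib]
    have hω : 300 * (d : ℝ) < ∑ i, matchPt M (ω i) := hω
    simp only [Finset.sum_const, Finset.card_univ, Fintype.card_fin, nsmul_eq_mul]
    push_cast
    exact mul_nonneg hη0.le (by linarith)
  · rw [← hθ]
    refine mul_le_mul_of_nonneg_left ?_ (by positivity)
    have ht : θ + η ≤ 1 / (2 * 10 ^ 6 * M) := by
      have : 1 / (2 * 10 ^ 6 * (M : ℝ)) = 5 * η := by rw [hη]; field_simp; norm_num
      linarith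
    have h1 : ∑ a, w' a * (Real.exp (θ * matchPt M a) * Real.exp (η * (matchPt M a - 3))) ≤
        Real.exp (-3 * η) * Real.exp (101 / 100 * (θ + η)) := by
      have h2 : ∀ a, w' a * (Real.exp (θ * matchPt M a) * Real.exp (η * (matchPt M a - 3))) ≤
          Real.exp (-3 * η) * (w' a + (θ + η) *
            (w' a * matchPt M a * Real.exp ((θ + η) * matchPt M a))) := by
        intro a
        have e : Real.exp (θ * matchPt M a) * Real.exp (η * (matchPt M a - 3)) =
            Real.exp (-3 * η) * Real.exp ((θ + η) * matchPt M a) := by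
          rw [← Real.exp_add, ← Real.exp_add]; congr 1; ring
        have e2 : Real.exp ((θ + η) * matchPt M a) ≤ 1 + (θ + η) * matchPt M a *
            Real.exp ((θ + η) * matchPt M a) := by
          have := Real.add_one_le_exp (-((θ + η) * matchPt M a))
          have hp := Real.exp_pos ((θ + η) * matchPt M a)
          have h3 := mul_le_mul_of_nonneg_right this hp.le
          rw [← Real.exp_add, neg_add_cancel, Real.exp_zero] at h3
          linarith
        rw [e]
        calc _ = Real.exp (-3 * η) * (w' a * Real.exp ((θ + η) * matchPt M a)) := by ring
          _ ≤ Real.exp (-3 * η) * (w' a * (1 + (θ + η) * matchPt M a *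
            Real.exp ((θ + η) * matchPt M a))) := by
              have := h.nonneg' a
              gcongr
          _ = _ := by ring
      refine (Finset.sum_le_sum fun a _ => h2 a).trans ?_
      rw [← Finset.mul_sum, Finset.sum_add_distrib, h.sum_eq_one', ← Finset.mul_sum]
      have h3 := h.mul_exp_le (θ + η) (by positivity) ht
      have h4 := Real.add_one_le_exp (101 / 100 * (θ + η) : ℝ)
      have h5 := mul_le_mul_of_nonneg_left h3 (by positivity : 0 ≤ θ + η)
      gcongr
      linarith
    calc _ ≤ (Real.exp (-(θ * μ)) *
          (Real.exp (-3 * η) * Real.exp (101 / 100 * (θ + η)))) ^ (100 * d) := by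
          have h0 : 0 ≤ ∑ a, w' a * (Real.exp (θ * matchPt M a) *
              Real.exp (η * (matchPt M a - 3))) :=
            Finset.sum_nonneg fun a _ => mul_nonneg (h.nonneg' a) (by positivity)
          gcongr
      _ ≤ Real.exp (-η) ^ (100 * d) := by
          rw [← Real.exp_add, ← Real.exp_add]
          gcongr
          nlinarith [mul_le_mul_of_nonneg_left hμ hθ0]
      _ = _ := by
          rw [← Real.exp_nat_mul]; congr 1; push_cast; rw [hη]; field_simp; norm_num

end bad

lemma sum_weights_mul {ι : Type*} [Fintype ι] {N m : ℕ} (w x : ι → ℝ) (G : (Fin m → Fin N) → ℝ) :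
    ∑ xs, iidE w (fun ω => ∏ k, x (ω (xs k))) * G xs =
      iidE w (fun ω => ∑ xs, (∏ k, x (ω (xs k))) * G xs) := by
  rw [iidE_sum]
  refine Finset.sum_congr rfl fun xs _ => ?_
  rw [mul_comm, ← iidE_const_mul]
  congr 1
  ext ω
  ring

/-- No function of `m = o(d / log d)` samples separates the measures with support at most `d` from
the measures that are nearly uniform on a large part of `100 * d` points. -/
theorem support_size_lower_bound {d m : ℕ} (hd : 2 ≤ d)
    (hm : (m : ℝ) < 1 / 10 ^ 14 * (d / Real.log d)) {G : (Fin m → Fin (100 * d)) → ℝ}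
    (hG0 : ∀ xs, 0 ≤ G xs) (hG1 : ∀ xs, G xs ≤ 1)
    (hsmall : ∀ u : Fin (100 * d) → ℝ, (∀ i, 0 ≤ u i) → 0 < ∑ i, u i →
      (Finset.univ.filter fun i => u i ≠ 0).card ≤ d →
      2 / 3 * (∑ i, u i) ^ m ≤ ∑ xs, (∏ k, u (xs k)) * G xs)
    (hbig : ∀ u : Fin (100 * d) → ℝ, (∀ i, 0 ≤ u i) →
      (Finset.univ.filter fun i => u i ≠ 1).card ≤ 10 * d → ∑ i, u i ≤ 300 * d →
      ∑ xs, (∏ k, u (xs k)) * G xs ≤ 45 / 100 * (∑ i, u i) ^ m) : False := by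
  classical
  have hd2 : (2 : ℝ) ≤ d := by exact_mod_cast hd
  have hlog : 0 < Real.log d := Real.log_pos (by linarith)
  -- Without samples `G` is a single number, and a point mass and the uniform weights already
  -- contradict each other. For `m ≥ 1` the bound on `m` forces `d` to be huge.
  rcases Nat.eq_zero_or_pos m with rfl | hm0
  · have h1 := hsmall (Pi.single ⟨0, by omega⟩ 1) (fun i => by
      by_cases h : i = ⟨0, by omega⟩
      · subst h; simp
      · simp [Pi.single_eq_of_ne h]) (by simp) (by
        refine (Finset.card_le_one.mpr fun i hi j hj => ?_).trans (by omega : 1 ≤ d)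
        simp only [Finset.mem_filter, Finset.mem_univ, true_and, Pi.single_apply, ne_eq,
          ite_eq_right_iff, one_ne_zero, imp_false, not_not] at hi hj
        rw [hi, hj])
    have h2 := hbig (fun _ => 1) (fun _ => zero_le_one) (by simp) (by
      simp only [Finset.sum_const, Finset.card_univ, Fintype.card_fin, nsmul_eq_mul]
      push_cast; linarith)
    simp only [pow_zero, Finset.univ_unique, Finset.univ_eq_empty, Finset.prod_empty, one_mul,
      Finset.sum_singleton, mul_one] at h1 h2
    linarith
  have hm1 : (1 : ℝ) ≤ m := by exact_mod_cast hm0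
  rw [← mul_div_assoc, lt_div_iff₀ hlog] at hm
  have hlog2 : Real.log 2 ≤ Real.log d := Real.log_le_log (by norm_num) hd2
  have hl2 := Real.log_two_gt_d9
  have hdbig : (10 : ℝ) ^ 13 ≤ d := by nlinarith
  -- the logarithm is small
  have hsq : Real.log d ≤ 2 * Real.sqrt d := by
    have := Real.log_le_sub_one_of_pos (Real.sqrt_pos.mpr (by linarith : (0 : ℝ) < d))
    rw [Real.log_sqrt (by linarith)] at this
    linarith
  have hsq2 : 3 * 10 ^ 6 ≤ Real.sqrt d := Real.le_sqrt_of_sq_le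
    (le_trans (by norm_num) hdbig)
  have hsq3 : Real.sqrt d * Real.sqrt d = d := Real.mul_self_sqrt (by linarith)
  have hlog100 : Real.log (100 * d : ℕ) ≤ 2 * Real.log d := by
    push_cast
    rw [Real.log_mul (by norm_num) (by linarith)]
    have := Real.log_le_log (by norm_num) (by linarith : (100 : ℝ) ≤ d)
    linarith
  have hlog1 : 1 ≤ Real.log d := by
    have := Real.log_le_log (by norm_num : (0 : ℝ) < 2 ^ 2) (by linarith : (2 : ℝ) ^ 2 ≤ d)
    rw [Real.log_pow] at this
    push_cast at this
    linarith
  -- Large enough that `N * exp (-M) ≤ 1 / N` for `N = 100 * d`, yet at most `5 * log d`, which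
  -- keeps `θ` below `1 / (10 ^ 7 * M)`.
  set M := ⌈2 * Real.log (100 * d : ℕ)⌉₊ with hMdef
  have hMlo : 2 * Real.log (100 * d : ℕ) ≤ M := Nat.le_ceil _
  have hMhi : (M : ℝ) ≤ 5 * Real.log d := by
    have := Nat.ceil_lt_add_one (a := 2 * Real.log (100 * d : ℕ))
      (mul_nonneg zero_le_two (Real.log_natCast_nonneg _))
    linarith
  have hlogle : Real.log d ≤ Real.log (100 * d : ℕ) :=
    Real.log_le_log (by linarith) (by push_cast; linarith)
  have hM : 0 < M := by
    have : (0 : ℝ) < M := by linarith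
    exact_mod_cast this
  have hM' : (1 : ℝ) ≤ M := by exact_mod_cast hM
  obtain ⟨w, w', h⟩ := exists_matchingLaws hM
  have hμge := h.mean_ge
  have hmean : ∑ a, w a * matchPt M a = ∑ a, w' a * matchPt M a := by
    simpa using h.moment_eq 1 hM
  set μ := ∑ a, w' a * matchPt M a with hμ
  have hN0 : (0 : ℝ) < (100 * d : ℕ) := by push_cast; linarith
  have hθ : m / ((100 * d : ℕ) * μ) ≤ 1 / (10 ^ 7 * M) := by
    rw [div_le_div_iff₀ (by positivity) (by positivity)]
    push_cast
    have : (m : ℝ) * M ≤ m * (5 * Real.log d) := by gcongr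
    nlinarith
  have hNM : ((100 * d : ℕ) : ℝ) * Real.exp (-(M : ℝ)) ≤ 1 / 100 := by
    have e1 : Real.exp (-(M : ℝ)) ≤ Real.exp (-(2 * Real.log (100 * d : ℕ))) := by gcongr
    have e2 : Real.exp (-(2 * Real.log (100 * d : ℕ))) = (((100 * d : ℕ) : ℝ) ^ 2)⁻¹ := by
      rw [Real.exp_neg, two_mul, Real.exp_add, Real.exp_log hN0, sq]
    calc _ ≤ ((100 * d : ℕ) : ℝ) * (((100 * d : ℕ) : ℝ) ^ 2)⁻¹ := by rw [← e2]; gcongr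
      _ = 1 / ((100 * d : ℕ) : ℝ) := by field_simp
      _ ≤ 1 / 100 := by
        apply one_div_le_one_div_of_le (by norm_num)
        push_cast; linarith
  obtain ⟨t1, t2⟩ := matching_transfer h hM (by omega) hNM hθ hG0 hG1
  set S := fun ω : Fin (100 * d) → Fin 3 ⊕ Fin M => ∑ i, matchPt M (ω i) with hS
  have hSnn : ∀ ω, 0 ≤ S ω := fun ω => Finset.sum_nonneg fun i _ => matchPt_nonneg _
  have b1 := large_support_le h (by omega : 0 < d) (by linarith : 0 < μ) hθ
  have b2 := few_ones_le h hM (by omega : 0 < d) (by linarith : 0 < μ) hθ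
  have b3 := large_sum_le h hM (by omega : 0 < d) hμge hθ
  have hexp : ∀ t : ℝ, 200 ≤ t → Real.exp (-t) ≤ 1 / 200 := by
    intro t ht
    rw [Real.exp_neg, ← one_div]
    exact one_div_le_one_div_of_le (by norm_num) (by linarith [Real.add_one_le_exp t])
  have hc0 : 0 ≤ ((100 * d : ℕ) * μ) ^ m := by positivity
  have x1 := hexp ((d : ℝ) / 2) (by linarith)
  have x2 := hexp (d / (10 ^ 5 * M)) (by
    rw [le_div_iff₀ (by positivity)]
    nlinarith)
  -- The tail bounds are relative to `(N * μ) ^ m`; this puts it below the totals they are compared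
  -- with.
  have zlo : ∀ v, (∀ a, 0 ≤ v a) → ∑ a, v a = 1 → ∑ a, v a * matchPt M a = μ →
      ((100 * d : ℕ) * μ) ^ m ≤ iidE v (fun ω : Fin (100 * d) → _ => S ω ^ m) := by
    intro v hv hv1 hvμ
    have := iidE_pow_mul_le (N := 100 * d) hv hv1 matchPt_nonneg 0 m
    simpa only [pow_zero, zero_add, iidE_const hv1, one_mul, hvμ] using this
  have z := zlo w h.nonneg h.sum_eq_one hmean
  have z' := zlo w' h.nonneg' h.sum_eq_one' rfl
  have hcpos : 0 < ((100 * d : ℕ) * μ) ^ m := by positivity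
  rw [sum_weights_mul, sum_weights_mul] at t1
  have low : 2 / 3 * iidE w (fun ω => S ω ^ m) ≤
      iidE w (fun ω => ∑ xs, (∏ k, matchPt M (ω (xs k))) * G xs) +
        iidE w (fun ω => S ω ^ m *
          {ω | d < (Finset.univ.filter fun i => matchPt M (ω i) ≠ 0).card}.indicator 1 ω) := by
    rw [← iidE_const_mul, ← iidE_add]
    refine iidE_mono h.nonneg fun ω => ?_
    have hT : 0 ≤ ∑ xs, (∏ k, matchPt M (ω (xs k))) * G xs :=
      Finset.sum_nonneg fun xs _ =>
        mul_nonneg (Finset.prod_nonneg fun k _ => matchPt_nonneg _) (hG0 xs)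
    have hSm : 0 ≤ S ω ^ m := pow_nonneg (hSnn ω) _
    by_cases hω : d < (Finset.univ.filter fun i => matchPt M (ω i) ≠ 0).card
    · rw [Set.indicator_of_mem (by exact hω)]
      simp only [Pi.one_apply]
      linarith
    · rw [Set.indicator_of_notMem (by exact hω)]
      -- Zero total mass defines no distribution, but then `S ω ^ m = 0` because `m > 0`.
      rcases (hSnn ω).eq_or_lt with h0 | h0
      · rw [← h0, zero_pow hm0.ne']; linarith
      · have := hsmall (fun i => matchPt M (ω i)) (fun i => matchPt_nonneg _) h0 (not_lt.mp hω)
        simpa using this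
  have high : iidE w' (fun ω => ∑ xs, (∏ k, matchPt M (ω (xs k))) * G xs) ≤
      45 / 100 * iidE w' (fun ω => S ω ^ m) + (iidE w' (fun ω => S ω ^ m *
          {ω | 10 * d < (Finset.univ.filter fun i => matchPt M (ω i) ≠ 1).card}.indicator 1 ω) +
        iidE w' (fun ω => S ω ^ m *
          {ω | 300 * (d : ℝ) < ∑ i, matchPt M (ω i)}.indicator 1 ω)) := by
    rw [← iidE_const_mul, ← iidE_add, ← iidE_add]
    refine iidE_mono h.nonneg' fun ω => ?_
    have hSm : 0 ≤ S ω ^ m := pow_nonneg (hSnn ω) _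
    have hT : ∑ xs, (∏ k, matchPt M (ω (xs k))) * G xs ≤ S ω ^ m := by
      rw [hS, Fintype.sum_pow]
      exact Finset.sum_le_sum fun xs _ => mul_le_of_le_one_right
        (Finset.prod_nonneg fun k _ => matchPt_nonneg _) (hG1 xs)
    have hi : ∀ B : Set (Fin (100 * d) → Fin 3 ⊕ Fin M), 0 ≤ S ω ^ m * B.indicator 1 ω :=
      fun B => mul_nonneg hSm (Set.indicator_nonneg (fun _ _ => zero_le_one) _)
    have hi' : ∀ B : Set (Fin (100 * d) → Fin 3 ⊕ Fin M), ω ∈ B →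
        S ω ^ m * B.indicator 1 ω = S ω ^ m := fun B hB => by simp [hB]
    by_cases hω : 10 * d < (Finset.univ.filter fun i => matchPt M (ω i) ≠ 1).card
    · have e := hi' {ω | 10 * d < (Finset.univ.filter fun i => matchPt M (ω i) ≠ 1).card} hω
      have := hi {ω | 300 * (d : ℝ) < ∑ i, matchPt M (ω i)}
      linarith
    by_cases hω2 : 300 * (d : ℝ) < ∑ i, matchPt M (ω i)
    · have e := hi' {ω | 300 * (d : ℝ) < ∑ i, matchPt M (ω i)} hω2
      have := hi {ω | 10 * d < (Finset.univ.filter fun i => matchPt M (ω i) ≠ 1).card}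
      linarith
    · have := hbig (fun i => matchPt M (ω i)) (fun i => matchPt_nonneg _) (not_lt.mp hω)
        (not_lt.mp hω2)
      have e1 := hi {ω | 10 * d < (Finset.univ.filter fun i => matchPt M (ω i) ≠ 1).card}
      have e2 := hi {ω | 300 * (d : ℝ) < ∑ i, matchPt M (ω i)}
      linarith
  -- Up to errors of one percent or less of the totals, the chain now reads `2 / 3 ≤ 45 / 100`.
  have y1 := mul_le_mul_of_nonneg_left x1 hc0
  have y2 := mul_le_mul_of_nonneg_left x2 hc0
  linarith

/-! ### Random labellings are far from a class of small VC dimension -/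

/-- In `∑ s, x ^ s.card = (1 + x) ^ N` each set counted here contributes at least `x ^ t`. -/
lemma card_filter_card_le {N : ℕ} (t : ℕ) {x : ℝ} (hx : 0 < x) (hx1 : x ≤ 1) :
    ((Finset.univ.filter fun s : Finset (Fin N) => s.card ≤ t).card : ℝ) ≤
      (1 / x) ^ t * (1 + x) ^ N := by
  have h := Fintype.sum_pow_mul_eq_add_pow (Fin N) x 1
  simp only [one_pow, mul_one, Fintype.card_fin] at h
  rw [add_comm, ← h, one_div, inv_pow, ← div_eq_inv_mul, le_div_iff₀ (by positivity),
    ← nsmul_eq_mul, ← Finset.sum_const]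
  refine (Finset.sum_le_sum fun s hs => ?_).trans
    (Finset.sum_le_sum_of_subset_of_nonneg (Finset.filter_subset _ _) fun _ _ _ => by positivity)
  exact pow_le_pow_of_le_one hx.le hx1 (Finset.mem_filter.mp hs).2

-- Sauer–Shelah in Pajor's form: a family has at most as many members as sets it shatters.
open Classical in
lemma card_patterns_le {𝒳 : Type*} {H : Set (𝒳 → Bool)} {d N : ℕ}
    (hVC : ∀ T, Shattered H T → T.card ≤ d) {y : Fin N → 𝒳} (hy : Function.Injective y) :
    (Finset.univ.filter fun p : Finset (Fin N) => ∃ g ∈ H, ∀ i, g (y i) = true ↔ i ∈ p).card ≤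
      (Finset.univ.filter fun s : Finset (Fin N) => s.card ≤ d).card := by
  refine (Finset.card_le_card_shatterer _).trans (Finset.card_le_card fun s hs => ?_)
  rw [Finset.mem_shatterer] at hs
  refine Finset.mem_filter.mpr ⟨Finset.mem_univ _, ?_⟩
  have := hVC (s.map ⟨y, hy⟩) fun l => by
    obtain ⟨p, hp, hsp⟩ := hs (Finset.filter_subset (fun i => l (y i) = true) s)
    obtain ⟨g, hg, hgp⟩ := (Finset.mem_filter.mp hp).2
    refine ⟨g, hg, fun x hx => ?_⟩
    obtain ⟨i, hi, rfl⟩ := Finset.mem_map.mp hx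
    have h1 := hgp i
    have h2 : i ∈ s ∩ p ↔ i ∈ Finset.filter (fun i => l (y i) = true) s := by rw [hsp]
    simp only [Finset.mem_inter, hi, true_and, Finset.mem_filter] at h2
    exact Bool.eq_iff_iff.mpr (h1.trans h2)
  rwa [Finset.card_map] at this

-- A near labelling is a pattern of `H` corrected on an error set of at most `11 * d` points.
-- Counting pairs suffices.
open Classical in
lemma card_near_labellings_le {𝒳 : Type*} {H : Set (𝒳 → Bool)} {d : ℕ} (hd : 0 < d)
    (hVC : ∀ T, Shattered H T → T.card ≤ d) {y : Fin (100 * d) → 𝒳}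
    (hy : Function.Injective y) :
    10 * ((Finset.univ.filter fun l : Fin (100 * d) → Bool => ∃ g ∈ H,
      (Finset.univ.filter fun i => g (y i) ≠ l i).card ≤ 11 * d).card : ℝ) ≤ 2 ^ (100 * d) := by
  set Pt := Finset.univ.filter fun p : Finset (Fin (100 * d)) =>
    ∃ g ∈ H, ∀ i, g (y i) = true ↔ i ∈ p with hPt
  set Er := Finset.univ.filter fun s : Finset (Fin (100 * d)) => s.card ≤ 11 * d with hEr
  have h1 : (Finset.univ.filter fun l : Fin (100 * d) → Bool => ∃ g ∈ H,
      (Finset.univ.filter fun i => g (y i) ≠ l i).card ≤ 11 * d) ⊆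
      (Pt ×ˢ Er).image fun p i => xor (decide (i ∈ p.1)) (decide (i ∈ p.2)) := by
    intro l hl
    obtain ⟨g, hg, hc⟩ := (Finset.mem_filter.mp hl).2
    refine Finset.mem_image.mpr ⟨(Finset.univ.filter fun i => g (y i) = true,
      Finset.univ.filter fun i => g (y i) ≠ l i), ?_, ?_⟩
    · simp only [Finset.mem_product, hPt, hEr, Finset.mem_filter, Finset.mem_univ, true_and]
      exact ⟨⟨g, hg, fun i => Iff.rfl⟩, hc⟩
    · ext i
      simp only [Finset.mem_filter, Finset.mem_univ, true_and]
      cases g (y i) <;> cases l i <;> simp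
  have h2 := (Finset.card_le_card h1).trans Finset.card_image_le
  rw [Finset.card_product] at h2
  -- The parameters `1 / 100` and `1 / 8` are close to the optimal `t / (N - t)` for `t = d` and `t
  -- = 11 * d`.
  have h3 : ((Pt.card * Er.card : ℕ) : ℝ) ≤
      ((1 / (1 / 100)) ^ d * (1 + 1 / 100) ^ (100 * d)) *
        ((1 / (1 / 8)) ^ (11 * d) * (1 + 1 / 8) ^ (100 * d)) := by
    push_cast
    refine mul_le_mul (le_trans ?_ (card_filter_card_le d (by norm_num) (by norm_num)))
      (card_filter_card_le (11 * d) (by norm_num) (by norm_num)) (by positivity) (by positivity)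
    exact_mod_cast card_patterns_le hVC hy
  have h4 : ((1 / (1 / 100)) ^ d * (1 + 1 / 100) ^ (100 * d)) *
        ((1 / (1 / 8)) ^ (11 * d) * (1 + 1 / 8) ^ (100 * d)) ≤
        ((2 : ℝ) ^ 100 / 10) ^ d := by
    rw [pow_mul, pow_mul, pow_mul, ← mul_pow, ← mul_pow, ← mul_pow]
    refine pow_le_pow_left₀ (by positivity) ?_ d
    norm_num
  have h5 : 10 * ((2 : ℝ) ^ 100 / 10) ^ d ≤ 2 ^ (100 * d) := by
    rw [div_pow, ← pow_mul, ← mul_div_assoc, div_le_iff₀ (by positivity), mul_comm]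
    have : (10 : ℝ) ^ 1 ≤ 10 ^ d := pow_le_pow_right₀ (by norm_num) hd
    rw [pow_one] at this
    gcongr
  have h6 : ((Finset.univ.filter fun l : Fin (100 * d) → Bool => ∃ g ∈ H,
      (Finset.univ.filter fun i => g (y i) ≠ l i).card ≤ 11 * d).card : ℝ) ≤
        ((Pt.card * Er.card : ℕ) : ℝ) := by exact_mod_cast h2
  linarith

/-- The finite core of the lower bound. `A l xs` is the probability that a tester accepts when the
points have the labels `l` and the random examples are the points with indices `xs`. -/
theorem no_finite_tester {𝒳 : Type*} {H : Set (𝒳 → Bool)} {d m : ℕ} (hd : 2 ≤ d)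
    (hm : (m : ℝ) < 1 / 10 ^ 14 * (d / Real.log d)) (hVC : ∀ T, Shattered H T → T.card ≤ d)
    {y : Fin (100 * d) → 𝒳} (hy : Function.Injective y)
    {A : (Fin (100 * d) → Bool) → (Fin m → Fin (100 * d)) → ℝ}
    (hA0 : ∀ l xs, 0 ≤ A l xs) (hA1 : ∀ l xs, A l xs ≤ 1)
    (hacc : ∀ l (u : Fin (100 * d) → ℝ), (∀ i, 0 ≤ u i) → 0 < ∑ i, u i →
      (Finset.univ.filter fun i => u i ≠ 0).card ≤ d →
      2 / 3 * (∑ i, u i) ^ m ≤ ∑ xs, (∏ k, u (xs k)) * A l xs)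
    (hrej : ∀ l (u : Fin (100 * d) → ℝ), (∀ i, 0 ≤ u i) → 0 < ∑ i, u i →
      (∀ g ∈ H, 1 / 300 * ∑ i, u i ≤ ∑ i with g (y i) ≠ l i, u i) →
      ∑ xs, (∏ k, u (xs k)) * A l xs ≤ 1 / 3 * (∑ i, u i) ^ m) : False := by
  classical
  have hcard : ∑ _l : Fin (100 * d) → Bool, (1 : ℝ) = 2 ^ (100 * d) := by simp
  have h2 : (0 : ℝ) < 2 ^ (100 * d) := by positivity
  have hswap : ∀ u : Fin (100 * d) → ℝ,
      ∑ xs : Fin m → Fin (100 * d), (∏ k, u (xs k)) * ((∑ l, A l xs) / 2 ^ (100 * d)) =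
      (∑ l, ∑ xs, (∏ k, u (xs k)) * A l xs) / 2 ^ (100 * d) := by
    intro u
    rw [Finset.sum_comm, Finset.sum_div]
    refine Finset.sum_congr rfl fun xs _ => ?_
    rw [← Finset.mul_sum, mul_div_assoc]
  -- `G` is the acceptance probability for a uniformly random labelling. In the large case it is at
  -- most `1 / 3 + 1 / 10`, the second term from labellings near `H`.
  refine support_size_lower_bound hd hm (G := fun xs => (∑ l, A l xs) / 2 ^ (100 * d))
    (fun xs => div_nonneg (Finset.sum_nonneg fun l _ => hA0 l xs) h2.le) (fun xs => ?_)
    (fun u hu hs hc => ?_) (fun u hu hc hs => ?_)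
  · rw [div_le_one h2, ← hcard]
    exact Finset.sum_le_sum fun l _ => hA1 l xs
  · rw [hswap, le_div_iff₀ h2, ← hcard, Finset.mul_sum]
    exact Finset.sum_le_sum fun l _ => by rw [mul_one]; exact hacc l u hu hs hc
  · have hones : 90 * d ≤ (Finset.univ.filter fun i => u i = 1).card := by
      have := Finset.card_filter_add_card_filter_not (s := Finset.univ)
        (fun i : Fin (100 * d) => u i = 1)
      rw [Finset.card_univ, Fintype.card_fin] at this
      have hc' : (Finset.univ.filter fun i => ¬u i = 1).card ≤ 10 * d := by convert hc
      omega
    have hs0 : 0 < ∑ i, u i := by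
      obtain ⟨i, hi⟩ := Finset.card_pos.mp (lt_of_lt_of_le (by omega) hones)
      have h1 := Finset.single_le_sum (f := u) (fun i _ => hu i) (Finset.mem_univ i)
      rw [(Finset.mem_filter.mp hi).2] at h1
      linarith
    set near := Finset.univ.filter fun l : Fin (100 * d) → Bool => ∃ g ∈ H,
      (Finset.univ.filter fun i => g (y i) ≠ l i).card ≤ 11 * d with hnear
    have hn := card_near_labellings_le (by omega : 0 < d) hVC hy
    rw [← hnear] at hn
    have hsm : 0 ≤ (∑ i, u i) ^ m := by positivity
    have hl : ∀ l, ∑ xs, (∏ k, u (xs k)) * A l xs ≤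
        1 / 3 * (∑ i, u i) ^ m + if l ∈ near then (∑ i, u i) ^ m else 0 := by
      intro l
      split_ifs with hln
      · have : ∑ xs, (∏ k, u (xs k)) * A l xs ≤ (∑ i, u i) ^ m := by
          rw [Fintype.sum_pow]
          exact Finset.sum_le_sum fun xs _ => mul_le_of_le_one_right
            (Finset.prod_nonneg fun k _ => hu _) (hA1 l xs)
        linarith
      · rw [add_zero]
        refine hrej l u hu hs0 fun g hg => ?_
        by_contra hlt
        rw [not_le] at hlt
        refine hln (Finset.mem_filter.mpr ⟨Finset.mem_univ _, g, hg, ?_⟩)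
        have h3 : ((Finset.univ.filter fun i => g (y i) ≠ l i ∧ u i = 1).card : ℝ) ≤
            ∑ i with g (y i) ≠ l i, u i := by
          rw [← nsmul_one, ← Finset.sum_const]
          refine (Finset.sum_le_sum fun i hi => ?_).trans
            (Finset.sum_le_sum_of_subset_of_nonneg (fun i hi => ?_) fun i _ _ => hu i)
          · exact (Finset.mem_filter.mp hi).2.2.ge
          · simp only [Finset.mem_filter, Finset.mem_univ, true_and] at hi ⊢
            exact hi.1
        have h4 : (Finset.univ.filter fun i => g (y i) ≠ l i ∧ u i = 1).card ≤ d := by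
          have : ((Finset.univ.filter fun i => g (y i) ≠ l i ∧ u i = 1).card : ℝ) ≤ d := by
            linarith
          exact_mod_cast this
        -- At most `d` errors at points of weight one and at most `10 * d` other points: together
        -- `11 * d`, so `l` would be near.
        have h5 : (Finset.univ.filter fun i => g (y i) ≠ l i) ⊆
            (Finset.univ.filter fun i => g (y i) ≠ l i ∧ u i = 1) ∪
              (Finset.univ.filter fun i => u i ≠ 1) := by
          intro i hi
          simp only [Finset.mem_filter, Finset.mem_univ, true_and, Finset.mem_union] at hi ⊢
          tauto
        have := (Finset.card_le_card h5).trans (Finset.card_union_le _ _)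
        omega
    rw [hswap, div_le_iff₀ h2]
    calc _ ≤ ∑ l : Fin (100 * d) → Bool, (1 / 3 * (∑ i, u i) ^ m * 1 +
          if l ∈ near then (∑ i, u i) ^ m else 0) :=
          Finset.sum_le_sum fun l _ => by rw [mul_one]; exact hl l
      _ = 1 / 3 * (∑ i, u i) ^ m * 2 ^ (100 * d) + near.card * (∑ i, u i) ^ m := by
          rw [Finset.sum_add_distrib, ← Finset.mul_sum, hcard]
          simp
      _ ≤ _ := by nlinarith

/-! ### Testers on finitely supported distributions -/

/-- The probability measure on `Fin N` proportional to the weights `u`. -/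
def finLaw {N : ℕ} (u : Fin N → ℝ) : Measure (Fin N) :=
  ∑ i, ENNReal.ofReal (u i / ∑ j, u j) • Measure.dirac i

section finLaw
variable {N : ℕ} {u : Fin N → ℝ}

lemma finLaw_apply (s : Set (Fin N)) [DecidablePred (· ∈ s)] :
    finLaw u s = ∑ i with i ∈ s, ENNReal.ofReal (u i / ∑ j, u j) := by
  rw [finLaw, Measure.finsetSum_apply, Finset.sum_filter]
  refine Finset.sum_congr rfl fun i _ => ?_
  rw [Measure.smul_apply, Measure.dirac_apply, smul_eq_mul]
  by_cases h : i ∈ s <;> simp [h]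

lemma finLaw_singleton (i : Fin N) : finLaw u {i} = ENNReal.ofReal (u i / ∑ j, u j) := by
  classical
  rw [finLaw_apply]
  simp only [Set.mem_singleton_iff]
  rw [Finset.filter_eq' Finset.univ i]
  simp

lemma isProbabilityMeasure_finLaw (hu : ∀ i, 0 ≤ u i) (hs : 0 < ∑ i, u i) :
    IsProbabilityMeasure (finLaw u) := by
  classical
  refine ⟨?_⟩
  rw [finLaw_apply, ← ENNReal.ofReal_sum_of_nonneg fun i _ => div_nonneg (hu i) hs.le,
    ← Finset.sum_div]
  simp [div_self hs.ne']

/-- The factor `(∑ i, u i) ^ m` clears the normalisation of `finLaw`, giving the unnormalised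
weights of the finite argument. -/
lemma toReal_prod_pi_finLaw {𝒳 Ω : Type*} [MeasurableSpace 𝒳] [MeasurableSpace Ω]
    (ν : Measure Ω) [IsProbabilityMeasure ν] (hu : ∀ i, 0 ≤ u i) (hs : 0 < ∑ i, u i)
    (y : Fin N → 𝒳) {m : ℕ} {E : Set (Ω × (Fin m → 𝒳))} (hE : MeasurableSet E) :
    ((ν.prod (Measure.pi fun _ : Fin m => (finLaw u).map y)) E).toReal * (∑ i, u i) ^ m =
      ∑ xs : Fin m → Fin N, (∏ k, u (xs k)) * (ν {ω | (ω, fun k => y (xs k)) ∈ E}).toReal := by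
  have := isProbabilityMeasure_finLaw hu hs
  have hy : Measurable y := measurable_of_finite y
  have hp : IsProbabilityMeasure ((finLaw u).map y) :=
    Measure.isProbabilityMeasure_map hy.aemeasurable
  have hY : Measurable fun (xs : Fin m → Fin N) k => y (xs k) := measurable_of_finite _
  have e1 : ν.prod (Measure.pi fun _ : Fin m => (finLaw u).map y) =
      (ν.prod (Measure.pi fun _ : Fin m => finLaw u)).map
        (Prod.map id fun xs k => y (xs k)) := by
    rw [← Measure.pi_map_pi fun _ => hy.aemeasurable, ← Measure.map_prod_map _ _ measurable_id hY,
      Measure.map_id]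
  have hpos : ∀ xs : Fin m → Fin N, 0 ≤ ∏ k, u (xs k) := fun xs =>
    Finset.prod_nonneg fun k _ => hu _
  rw [e1, Measure.map_apply (measurable_id.prodMap hY) hE, Measure.prod_apply_symm
    ((measurable_id.prodMap hY) hE), lintegral_fintype, ENNReal.toReal_sum, Finset.sum_mul]
  · refine Finset.sum_congr rfl fun xs _ => ?_
    rw [Measure.pi_singleton, ENNReal.toReal_mul, ENNReal.toReal_prod]
    simp only [finLaw_singleton]
    have e2 : ∀ k, (ENNReal.ofReal (u (xs k) / ∑ j, u j)).toReal = u (xs k) / ∑ j, u j :=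
      fun k => ENNReal.toReal_ofReal (div_nonneg (hu _) hs.le)
    simp only [e2, Finset.prod_div_distrib, Finset.prod_const, Finset.card_univ, Fintype.card_fin]
    rw [mul_assoc, div_mul_cancel₀ _ (pow_ne_zero _ hs.ne'), mul_comm]
    rfl
  · intro xs _
    exact ENNReal.mul_ne_top (measure_ne_top _ _) (measure_ne_top _ _)

end finLaw

lemma measurable_extend_bool {𝒳 : Type*} [MeasurableSpace 𝒳] [MeasurableSingletonClass 𝒳]
    {N : ℕ} {y : Fin N → 𝒳} (l : Fin N → Bool) :
    Measurable (Function.extend y l fun _ => false) := by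
  classical
  refine measurable_to_bool (Set.Finite.measurableSet ((Set.finite_range y).subset ?_))
  intro x hx
  by_contra h
  simp only [Set.mem_preimage, Set.mem_singleton_iff] at hx
  rw [Function.extend_apply' _ _ _ (by simpa using h)] at hx
  exact absurd hx (by simp)

/-- A randomized procedure `out` with seed law `ν`, reading `m` random points, cannot accept all
finitely supported distributions consistent with `H` while rejecting the ones far from `H`. -/
theorem no_tester {𝒳 Ω : Type*} [MeasurableSpace 𝒳] [MeasurableSingletonClass 𝒳]
    [MeasurableSpace Ω] (ν : Measure Ω) [IsProbabilityMeasure ν]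
    {H : Set (𝒳 → Bool)} {d m : ℕ} (hd : 2 ≤ d)
    (hm : (m : ℝ) < 1 / 10 ^ 14 * (d / Real.log d)) (hVC : ∀ T, Shattered H T → T.card ≤ d)
    {y : Fin (100 * d) → 𝒳} (hy : Function.Injective y)
    {out : (𝒳 → Bool) → Ω × (Fin m → 𝒳) → Bool} (hout : ∀ f, Measurable f → Measurable (out f))
    (hacc : ∀ (l : Fin (100 * d) → Bool) (T : Finset (Fin (100 * d))), T.card ≤ d →
      ∃ f : 𝒳 → Bool, Measurable f ∧
        (∀ (D : Measure 𝒳) [IsProbabilityMeasure D], D {x | ∃ i ∈ T, y i = x}ᶜ = 0 →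
          2 / 3 ≤ (ν.prod (Measure.pi fun _ : Fin m => D)) {p | out f p = true}) ∧
        ∀ xs : Fin m → Fin (100 * d), (∀ k, xs k ∈ T) → ∀ ω, out f (ω, fun k => y (xs k)) =
          out (Function.extend y l fun _ => false) (ω, fun k => y (xs k)))
    (hrej : ∀ (l : Fin (100 * d) → Bool) (D : Measure 𝒳) [IsProbabilityMeasure D],
      ENNReal.ofReal (1 / 300) ≤ distToClass D (Function.extend y l fun _ => false) H →
      2 / 3 ≤ (ν.prod (Measure.pi fun _ : Fin m => D))
        {p | out (Function.extend y l fun _ => false) p = false}) : False := by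
  classical
  have h23 : ((2 : ℝ≥0∞) / 3).toReal = 2 / 3 := by simp
  have hym : Measurable y := measurable_of_finite y
  refine no_finite_tester (H := H) (m := m) hd hm hVC hy
    (A := fun l xs => (ν {ω | out (Function.extend y l fun _ => false)
      (ω, fun k => y (xs k)) = true}).toReal)
    (fun l xs => ENNReal.toReal_nonneg) (fun l xs => ?_) (fun l u hu hs hc => ?_)
    (fun l u hu hs hfar => ?_)
  · exact ENNReal.toReal_mono ENNReal.one_ne_top prob_le_one
  · have := isProbabilityMeasure_finLaw hu hs
    have hp : IsProbabilityMeasure ((finLaw u).map y) :=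
      Measure.isProbabilityMeasure_map hym.aemeasurable
    obtain ⟨f, hfm, hf2, hf3⟩ := hacc l (Finset.univ.filter fun i => u i ≠ 0) hc
    have h1 := hf2 ((finLaw u).map y) (by
      rw [Measure.map_apply hym]
      · rw [finLaw_apply]
        refine Finset.sum_eq_zero fun i hi => ?_
        have : u i = 0 := by
          by_contra h
          have hi := (Finset.mem_filter.mp hi).2
          exact hi ⟨i, by simpa using h, rfl⟩
        simp [this]
      · refine (Set.Finite.measurableSet ((Set.finite_range y).subset ?_)).compl
        rintro x ⟨i, -, rfl⟩
        exact ⟨i, rfl⟩)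
    have h2 := toReal_prod_pi_finLaw ν hu hs y (m := m) (E := {p | out f p = true})
      (hout f hfm (measurableSet_singleton true))
    have h3 := ENNReal.toReal_mono (measure_ne_top _ _) h1
    rw [h23] at h3
    calc 2 / 3 * (∑ i, u i) ^ m ≤ _ := mul_le_mul_of_nonneg_right h3 (by positivity)
      _ = _ := h2
      _ = _ := by
        refine Finset.sum_congr rfl fun xs _ => ?_
        -- Samples leaving the support of `u` have weight zero, so `f` may replace the extended
        -- labelling.
        by_cases hxs : ∀ k, u (xs k) ≠ 0
        · have := hf3 xs fun k => by simpa using hxs k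
          simp only [Set.mem_ofPred_eq, this]
        · push Not at hxs
          obtain ⟨k, hk⟩ := hxs
          rw [Finset.prod_eq_zero (Finset.mem_univ k) hk, zero_mul, zero_mul]
  · have := isProbabilityMeasure_finLaw hu hs
    have hp : IsProbabilityMeasure ((finLaw u).map y) :=
      Measure.isProbabilityMeasure_map hym.aemeasurable
    have hfm := measurable_extend_bool (y := y) l
    have h1 := hrej l ((finLaw u).map y) (by
      refine le_iInf₂ fun g hg => ?_
      refine le_trans ?_ (Measure.le_map_apply hym.aemeasurable _)
      rw [finLaw_apply, ← ENNReal.ofReal_sum_of_nonneg fun i _ => div_nonneg (hu i) hs.le,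
        ← Finset.sum_div]
      refine ENNReal.ofReal_le_ofReal ?_
      rw [le_div_iff₀ hs]
      refine (hfar g hg).trans (le_of_eq (Finset.sum_congr ?_ fun _ _ => rfl))
      ext i
      simp [hy.extend_apply, eq_comm])
    set E := {p | out (Function.extend y l fun _ => false) p = true} with hE
    have hEm : MeasurableSet (E : Set (Ω × (Fin m → 𝒳))) :=
      hout _ hfm (measurableSet_singleton true)
    have hc : {p : Ω × (Fin m → 𝒳) | out (Function.extend y l fun _ => false) p = false} = Eᶜ := by
      ext p; simp [hE]
    have h2 := toReal_prod_pi_finLaw ν hu hs y (m := m) hEm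
    rw [hc] at h1
    have h3 := ENNReal.toReal_mono (measure_ne_top _ _) h1
    rw [h23] at h3
    have h4 := probReal_compl_eq_one_sub (μ := ν.prod (Measure.pi fun _ : Fin m =>
      (finLaw u).map y)) hEm
    simp only [measureReal_def] at h4
    rw [h4] at h3
    have h5 : 0 ≤ (∑ i, u i) ^ m := by positivity
    refine le_trans (le_of_eq h2.symm) (mul_le_mul_of_nonneg_right ?_ h5)
    linarith

/-- Acceptance is promised only for members of `H`, so `f` is a member agreeing with `l` on `T`; the
algorithm sees labels at sampled points only and cannot notice the difference. -/
lemma SampleAlgorithm.not_isTester {𝒳 : Type*} [MeasurableSpace 𝒳] [MeasurableSingletonClass 𝒳]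
    {H : Set (𝒳 → Bool)} {d m : ℕ} (hd : 2 ≤ d)
    (hm : (m : ℝ) < 1 / 10 ^ 14 * (d / Real.log d)) (hVC : ∀ T, Shattered H T → T.card ≤ d)
    {y : Fin (100 * d) → 𝒳} (hy : Function.Injective y) (hH : ∀ g ∈ H, Measurable g)
    (hsh : ∀ (l : Fin (100 * d) → Bool) (T : Finset (Fin (100 * d))), T.card ≤ d →
      ∃ g ∈ H, ∀ i ∈ T, g (y i) = l i) {ε : ℝ} (hε : ε < 1 / 300)
    (A : SampleAlgorithm 𝒳 m) : ¬ A.IsTester H ε := by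
  intro hA
  refine no_tester A.seedLaw hd hm hVC hy
    (out := fun f p => A.output (p.1, fun i => (p.2 i, f (p.2 i)))) (fun f hf => ?_)
    (fun l T hT => ?_) (fun l D hD hdist => ?_)
  · refine A.measurable_output.comp (measurable_fst.prodMk (measurable_pi_lambda _ fun i => ?_))
    have h : Measurable fun p : A.Seed × (Fin m → 𝒳) => p.2 i :=
      (measurable_pi_apply i).comp measurable_snd
    exact h.prodMk (hf.comp h)
  · obtain ⟨g, hg, hgl⟩ := hsh l T hT
    refine ⟨g, hH g hg, fun D hD _ => (hA D g (hH g hg)).1 hg, fun xs hxs ω => ?_⟩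
    congr 2
    ext i : 1
    rw [hy.extend_apply, hgl _ (hxs i)]
  · exact (hA D _ (measurable_extend_bool l)).2
      (lt_of_lt_of_le ((ENNReal.ofReal_lt_ofReal_iff (by norm_num)).mpr hε) hdist)

lemma QueryAlgorithm.measurable_transcript {𝒳 : Type*} [MeasurableSpace 𝒳] {q : ℕ}
    (A : QueryAlgorithm 𝒳 q) {f : 𝒳 → Bool} (hf : Measurable f) (k : ℕ) (hk : k ≤ q) :
    Measurable fun p : A.Seed × (Fin q → 𝒳) => A.transcript f p.1 p.2 k hk := by
  induction k with
  | zero => exact measurable_pi_lambda _ fun i => i.elim0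
  | succ k ih =>
    have h1 := ih (Nat.le_of_succ_le hk)
    have h2 : Measurable fun p : A.Seed × (Fin q → 𝒳) =>
        A.move k (p.1, A.transcript f p.1 p.2 k (Nat.le_of_succ_le hk)) :=
      (A.measurable_move k).comp (measurable_fst.prodMk h1)
    have h3 : Measurable fun p : A.Seed × (Fin q → 𝒳) => p.2 ⟨k, hk⟩ :=
      (measurable_pi_apply _).comp measurable_snd
    have h4 : Measurable fun z : (Unit ⊕ 𝒳) × 𝒳 => Sum.elim (fun _ => z.2) id z.1 := by
      have : Measurable (Sum.elim Prod.snd Prod.fst : (Unit × 𝒳) ⊕ (𝒳 × 𝒳) → 𝒳) :=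
        measurable_snd.sumElim measurable_fst
      convert this.comp (MeasurableEquiv.sumProdDistrib Unit 𝒳 𝒳).measurable using 1
      ext ⟨a | a, b⟩ <;> rfl
    have h5 := h4.comp (h2.prodMk h3)
    refine measurable_pi_lambda _ fun i => ?_
    refine Fin.lastCases ?_ (fun j => ?_) i
    · simp only [QueryAlgorithm.transcript, Fin.snoc_last]
      exact h5.prodMk (hf.comp h5)
    · simp only [QueryAlgorithm.transcript, Fin.snoc_castSucc]
      exact (measurable_pi_apply j).comp h1

/-- Queries off the support could distinguish a member of `H` from the extended labelling, so `f` is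
the extension itself. It has distance `0` from `H`, which is what tolerance provides for. -/
lemma QueryAlgorithm.not_isTolerantTester {𝒳 : Type*} [MeasurableSpace 𝒳]
    [MeasurableSingletonClass 𝒳] {H : Set (𝒳 → Bool)} {d q : ℕ} (hd : 2 ≤ d)
    (hq : (q : ℝ) < 1 / 10 ^ 14 * (d / Real.log d)) (hVC : ∀ T, Shattered H T → T.card ≤ d)
    {y : Fin (100 * d) → 𝒳} (hy : Function.Injective y)
    (hsh : ∀ (l : Fin (100 * d) → Bool) (T : Finset (Fin (100 * d))), T.card ≤ d →
      ∃ g ∈ H, ∀ i ∈ T, g (y i) = l i) {ε : ℝ} (hε : ε < 1 / 300)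
    (A : QueryAlgorithm 𝒳 q) : ¬ A.IsTolerantTester H 0 ε := by
  intro hA
  refine no_tester A.seedLaw hd hq hVC hy
    (out := fun f p => A.output (p.1, A.transcript f p.1 p.2 q le_rfl)) (fun f hf => ?_)
    (fun l T hT => ?_) (fun l D hD hdist => ?_)
  · exact A.measurable_output.comp (measurable_fst.prodMk (A.measurable_transcript hf q le_rfl))
  · have hm := measurable_extend_bool (y := y) l
    refine ⟨_, hm, fun D hD hDT => ?_, fun _ _ _ => rfl⟩
    refine (hA D _ hm).1 ?_
    obtain ⟨g, hg, hgl⟩ := hsh l T hT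
    rw [ENNReal.ofReal_zero]
    refine (iInf₂_le g hg).trans (le_of_eq (measure_mono_null ?_ hDT))
    rintro x hx ⟨i, hi, rfl⟩
    refine hx ?_
    rw [hy.extend_apply, hgl i hi]
  · exact (hA D _ (measurable_extend_bool l)).2 ((ENNReal.ofReal_le_ofReal hε.le).trans hdist)

/-- A class of measurable functions of VC dimension at most `d` has the testing lower bound if
`100 * d` points can be chosen such that `H` shatters every `d` of them. -/
theorem testingLowerBound_of_points {𝒳 : Type*} [MeasurableSpace 𝒳] [MeasurableSingletonClass 𝒳]
    {H : Set (𝒳 → Bool)} {d : ℕ} (hd : 2 ≤ d) (hVC : ∀ T, Shattered H T → T.card ≤ d)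
    {y : Fin (100 * d) → 𝒳} (hy : Function.Injective y) (hH : ∀ g ∈ H, Measurable g)
    (hsh : ∀ (l : Fin (100 * d) → Bool) (T : Finset (Fin (100 * d))), T.card ≤ d →
      ∃ g ∈ H, ∀ i ∈ T, g (y i) = l i) {ε : ℝ} (hε : ε < 1 / 300) :
    TestingLowerBound H ε (1 / 10 ^ 14) d := by
  have key : ∀ s : ℕ∞, (⌈1 / 10 ^ 14 * (d / Real.log d)⌉₊ : ℕ∞) ≤ s →
      ENNReal.ofReal (1 / 10 ^ 14 * (d / Real.log d)) ≤ (s : ℝ≥0∞) := by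
    intro s hs
    have h1 : ENNReal.ofReal (1 / 10 ^ 14 * (d / Real.log d)) ≤
        (⌈1 / 10 ^ 14 * (d / Real.log d)⌉₊ : ℝ≥0∞) :=
      ENNReal.ofReal_le_of_le_toReal (by simpa using Nat.le_ceil _)
    exact h1.trans (by exact_mod_cast hs)
  refine ⟨key _ (le_iInf₂ fun m hm => ?_), key _ (le_iInf₂ fun q hq => ?_)⟩
  · obtain ⟨A, hA⟩ := hm
    by_contra h
    refine A.not_isTester hd ?_ hVC hy hH hsh hε hA
    exact Nat.lt_ceil.mp (by exact_mod_cast not_le.mp h)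
  · obtain ⟨A, hA⟩ := hq
    by_contra h
    refine A.not_isTolerantTester hd ?_ hVC hy hsh hε hA
    exact Nat.lt_ceil.mp (by exact_mod_cast not_le.mp h)

/-! ### Dudley classes: VC dimension and points in general position -/

lemma exists_ne_zero_vanishing {𝒳 : Type*} {F : Submodule ℝ (𝒳 → ℝ)} {T : Finset 𝒳}
    (hT : (T.card : Cardinal) < Module.rank ℝ F) : ∃ g ∈ F, g ≠ 0 ∧ ∀ x ∈ T, g x = 0 := by
  by_contra! h
  let ev : F →ₗ[ℝ] (T → ℝ) := (LinearMap.funLeft ℝ ℝ (Subtype.val : T → 𝒳)).comp F.subtype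
  have hinj : Function.Injective ev := by
    rw [← LinearMap.ker_eq_bot, LinearMap.ker_eq_bot']
    intro f hf
    by_contra hne
    obtain ⟨x, hx, hfx⟩ := h f f.2 (by simpa using hne)
    exact hfx (congrFun hf ⟨x, hx⟩)
  have h1 := LinearMap.rank_le_of_injective ev hinj
  rw [rank_fun', Fintype.card_coe] at h1
  exact absurd h1 (not_le.mpr hT)

/-- Any `d` points of `Y` can be interpolated by `F`. -/
def Interpolates {𝒳 : Type*} (F : Submodule ℝ (𝒳 → ℝ)) (d : ℕ) (Y : Finset 𝒳) : Prop :=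
  ∀ T ⊆ Y, T.card ≤ d → ∀ v : 𝒳 → ℝ, ∃ f ∈ F, ∀ x ∈ T, f x = v x

/-- Finitely many nonzero members of `F` have a common point where none of them vanishes. -/
def HasCommonNonzeros {𝒳 : Type*} (F : Submodule ℝ (𝒳 → ℝ)) : Prop :=
  ∀ S : Finset (𝒳 → ℝ), (∀ g ∈ S, g ∈ F ∧ g ≠ 0) → ∃ x, ∀ g ∈ S, g x ≠ 0

-- For each `T ⊆ Y` with fewer than `d` points some nonzero member of `F` vanishes on `T`. A point
-- where none of these finitely many functions vanishes can be added: a multiple of the function for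
-- `T` corrects the value there without disturbing `T`.
open Classical in
lemma Interpolates.exists_insert {𝒳 : Type*} {F : Submodule ℝ (𝒳 → ℝ)}
    (hF : HasCommonNonzeros F) {d : ℕ} (hd : 2 ≤ d) (hrank : (d : Cardinal) ≤ Module.rank ℝ F)
    {Y : Finset 𝒳} (hY : Interpolates F d Y) : ∃ x ∉ Y, Interpolates F d (insert x Y) := by
  have hg : ∀ T : Finset 𝒳, T.card < d → ∃ g ∈ F, g ≠ 0 ∧ ∀ x ∈ T, g x = 0 := fun T hT =>
    exists_ne_zero_vanishing (lt_of_lt_of_le (by exact_mod_cast hT) hrank)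
  choose! g hgF hg0 hgT using hg
  obtain ⟨x, hx⟩ := hF ((Y.powerset.filter fun T => T.card < d).image g) (fun f hf => by
    obtain ⟨T, hT, rfl⟩ := Finset.mem_image.mp hf
    have := (Finset.mem_filter.mp hT).2
    exact ⟨hgF T this, hg0 T this⟩)
  have hx' : ∀ T ⊆ Y, T.card < d → g T x ≠ 0 := fun T hTY hT =>
    hx _ (Finset.mem_image_of_mem _ (Finset.mem_filter.mpr ⟨Finset.mem_powerset.mpr hTY, hT⟩))
  refine ⟨x, fun hxY => ?_, fun T hT hTd v => ?_⟩
  -- Here `2 ≤ d` matters: the function for `{x}` would vanish at `x`.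
  · have h1 : ({x} : Finset 𝒳).card < d := by rw [Finset.card_singleton]; omega
    exact hx' {x} (by simpa using hxY) h1 (hgT {x} h1 x (by simp))
  · by_cases hxT : x ∈ T
    · have hTY : T.erase x ⊆ Y := fun z hz => by
        have h1 := Finset.mem_erase.mp hz
        exact (Finset.mem_insert.mp (hT h1.2)).resolve_left h1.1
      have hTc : (T.erase x).card < d := by
        have := Finset.card_erase_lt_of_mem hxT
        omega
      obtain ⟨f, hf, hfv⟩ := hY _ hTY hTc.le v
      have hgx := hx' _ hTY hTc
      refine ⟨f + ((v x - f x) / g (T.erase x) x) • g (T.erase x),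
        F.add_mem hf (F.smul_mem _ (hgF _ hTc)), fun z hz => ?_⟩
      by_cases hzx : z = x
      · subst hzx
        simp only [Pi.add_apply, Pi.smul_apply, smul_eq_mul]
        field_simp
        ring
      · have hz' : z ∈ T.erase x := Finset.mem_erase.mpr ⟨hzx, hz⟩
        simp [hgT _ hTc z hz', hfv z hz']
    · exact hY T (fun z hz => (Finset.mem_insert.mp (hT hz)).resolve_left
        fun h => hxT (h ▸ hz)) hTd v

lemma exists_interpolates {𝒳 : Type*} {F : Submodule ℝ (𝒳 → ℝ)} (hF : HasCommonNonzeros F)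
    {d : ℕ} (hd : 2 ≤ d) (hrank : (d : Cardinal) ≤ Module.rank ℝ F) (n : ℕ) :
    ∃ Y : Finset 𝒳, Y.card = n ∧ Interpolates F d Y := by
  classical
  induction n with
  | zero =>
    refine ⟨∅, rfl, fun T hT _ v => ⟨0, F.zero_mem, fun x hx => ?_⟩⟩
    exact absurd (hT hx) (by simp)
  | succ n ih =>
    obtain ⟨Y, hYc, hY⟩ := ih
    obtain ⟨x, hx, hxY⟩ := hY.exists_insert hF hd hrank
    exact ⟨insert x Y, by rw [Finset.card_insert_of_notMem hx, hYc], hxY⟩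

lemma exists_shattering_points {𝒳 : Type*} {F : Submodule ℝ (𝒳 → ℝ)} (hF : HasCommonNonzeros F)
    {d : ℕ} (hd : 2 ≤ d) (hrank : (d : Cardinal) ≤ Module.rank ℝ F) (h : 𝒳 → ℝ) (N : ℕ) :
    ∃ y : Fin N → 𝒳, Function.Injective y ∧ ∀ (l : Fin N → Bool) (T : Finset (Fin N)),
      T.card ≤ d → ∃ g ∈ dudleyClass F h, ∀ i ∈ T, g (y i) = l i := by
  classical
  obtain ⟨Y, hYc, hY⟩ := exists_interpolates hF hd hrank N
  let e := (Y.equivFinOfCardEq hYc).symm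
  have hinj : Function.Injective fun i => (e i : 𝒳) := Subtype.val_injective.comp e.injective
  refine ⟨fun i => e i, hinj, fun l T hT => ?_⟩
  obtain ⟨f, hf, hfv⟩ := hY (T.image fun i => (e i : 𝒳)) (fun x hx => by
      obtain ⟨i, -, rfl⟩ := Finset.mem_image.mp hx
      exact (e i).2) (Finset.card_image_le.trans hT)
    (fun x => Function.extend (fun i => (e i : 𝒳)) (fun i => if l i then (1 : ℝ) else -1) 0 x - h x)
  refine ⟨fun x => sgn (f x + h x), ⟨f, hf, fun x => rfl⟩, fun i hi => ?_⟩
  simp only [hfv _ (Finset.mem_image_of_mem _ hi), sub_add_cancel, hinj.extend_apply, sgn]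
  cases l i <;> norm_num

/-- On more points than the dimension the evaluations of `F` satisfy a relation `c`. Labelling `+1`
exactly where `c < 0` makes all terms `c x * (f x + h x)` nonpositive, while their sum `∑ c x * h x`
does not depend on `f`. When that sum is zero, a point with `c x > 0` gives a strict inequality,
because label `-1` means strictly negative. -/
lemma card_le_finrank_of_shattered {𝒳 : Type*} {F : Submodule ℝ (𝒳 → ℝ)} [FiniteDimensional ℝ F]
    {h : 𝒳 → ℝ} {T : Finset 𝒳} (hT : Shattered (dudleyClass F h) T) :
    T.card ≤ Module.finrank ℝ F := by
  classical
  by_contra! hlt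
  let ev : F →ₗ[ℝ] (T → ℝ) := (LinearMap.funLeft ℝ ℝ (Subtype.val : T → 𝒳)).comp F.subtype
  have hne : LinearMap.range ev < ⊤ := by
    rw [lt_top_iff_ne_top]
    intro htop
    have h1 := LinearMap.finrank_range_le ev
    rw [htop, finrank_top, Module.finrank_fintype_fun_eq_card, Fintype.card_coe] at h1
    omega
  obtain ⟨φ, hφ0, hφ⟩ := Submodule.exists_le_ker_of_lt_top _ hne
  have hφsum : ∀ v : T → ℝ, φ v = ∑ x, v x * φ (Pi.single x 1) := fun v => by
    rw [LinearMap.pi_apply_eq_sum_univ φ v]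
    refine Finset.sum_congr rfl fun x _ => ?_
    rw [smul_eq_mul]
    congr 2
    ext z
    simp [Pi.single_apply, eq_comm]
  have hcne : ∃ x, φ (Pi.single x 1) ≠ 0 := by
    by_contra! h0
    refine hφ0 (LinearMap.ext fun v => ?_)
    rw [hφsum v]
    simp [h0]
  -- a relation among the point evaluations, with a sign that the labelling will contradict
  obtain ⟨c, hc, hc0⟩ : ∃ c : T → ℝ, (∀ f ∈ F, ∑ x : T, c x * f x = 0) ∧
      (0 < ∑ x : T, c x * h x ∨ (∑ x : T, c x * h x = 0 ∧ ∃ x, 0 < c x)) := by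
    have hrel : ∀ f ∈ F, ∑ x : T, φ (Pi.single x 1) * f x = 0 := fun f hf => by
      have h1 : φ (ev ⟨f, hf⟩) = 0 := hφ ⟨_, rfl⟩
      rw [hφsum] at h1
      rw [← h1]
      exact Finset.sum_congr rfl fun x _ => mul_comm _ _
    have hrel' : ∀ f ∈ F, ∑ x : T, -φ (Pi.single x 1) * f x = 0 := fun f hf => by
      simp only [neg_mul, Finset.sum_neg_distrib, hrel f hf, neg_zero]
    have hneg : ∑ x : T, -φ (Pi.single x 1) * h x = -∑ x : T, φ (Pi.single x 1) * h x := by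
      simp only [neg_mul, Finset.sum_neg_distrib]
    rcases lt_trichotomy (∑ x : T, φ (Pi.single x 1) * h x) 0 with h1 | h1 | h1
    · exact ⟨_, hrel', Or.inl (by linarith)⟩
    · obtain ⟨x, hx⟩ := hcne
      rcases lt_or_gt_of_ne hx with h2 | h2
      · exact ⟨_, hrel', Or.inr ⟨by linarith, x, by linarith⟩⟩
      · exact ⟨_, hrel, Or.inr ⟨h1, x, h2⟩⟩
    · exact ⟨_, hrel, Or.inl h1⟩
  obtain ⟨g, ⟨f, hf, hgf⟩, hg⟩ := hT fun x => if hx : x ∈ T then decide (c ⟨x, hx⟩ < 0) else true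
  have hsum : ∑ x : T, c x * (f x + h x) = ∑ x : T, c x * h x := by
    simp only [mul_add, Finset.sum_add_distrib, hc f hf, zero_add]
  have hsgn : ∀ x : T, (c x < 0 ↔ 0 ≤ f x + h x) := fun x => by
    have h1 := hg x x.2
    rw [hgf] at h1
    simp only [sgn, Finset.coe_mem, dite_true, Subtype.coe_eta, decide_eq_decide] at h1
    exact h1.symm
  have hle : ∀ x : T, c x * (f x + h x) ≤ 0 := fun x => by
    rcases lt_or_ge (c x) 0 with h1 | h1
    · exact mul_nonpos_of_nonpos_of_nonneg h1.le ((hsgn x).mp h1)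
    · have := not_le.mp (mt (hsgn x).mpr (not_lt.mpr h1))
      exact mul_nonpos_of_nonneg_of_nonpos h1 this.le
  rcases hc0 with h1 | ⟨h1, x, hx⟩
  · have := Finset.sum_nonpos (s := Finset.univ) fun x _ => hle x
    linarith
  · have h2 : ∑ x : T, c x * (f x + h x) < 0 := by
      refine Finset.sum_neg' (fun x _ => hle x) ⟨x, Finset.mem_univ _, ?_⟩
      exact mul_neg_of_pos_of_neg hx (not_le.mp (mt (hsgn x).mpr (not_lt.mpr hx.le)))
    linarith

/-- By the identity theorem no function in `S` vanishes on a nonempty open subset of `X`, so `V` can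
be shrunk to avoid their zeros one by one. -/
lemma exists_mem_forall_ne_zero {E : Type*} [NormedAddCommGroup E] [NormedSpace ℝ E]
    {X : Set E} (hX : IsPreconnected X) (S : Finset (E → ℝ))
    (hS : ∀ φ ∈ S, AnalyticOnNhd ℝ φ X ∧ ∃ x ∈ X, φ x ≠ 0) {V : Set E} (hV : IsOpen V)
    (hVne : V.Nonempty) (hVX : V ⊆ X) : ∃ x ∈ V, ∀ φ ∈ S, φ x ≠ 0 := by
  classical
  induction S using Finset.induction_on generalizing V with
  | empty => obtain ⟨x, hx⟩ := hVne; exact ⟨x, hx, by simp⟩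
  | insert φ S _ ih =>
    obtain ⟨hφ, x, hx, hφx⟩ := hS φ (Finset.mem_insert_self _ _)
    have h1 : ∃ z ∈ V, φ z ≠ 0 := by
      by_contra! h
      obtain ⟨z, hz⟩ := hVne
      exact hφx (hφ.eqOn_zero_of_preconnected_of_eventuallyEq_zero hX (hVX hz)
        (Filter.eventually_of_mem (hV.mem_nhds hz) h) hx)
    obtain ⟨z, hz, hφz⟩ := h1
    have hopen : IsOpen (V ∩ φ ⁻¹' {0}ᶜ) :=
      (hφ.continuousOn.mono hVX).isOpen_inter_preimage hV isOpen_compl_singleton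
    obtain ⟨u, hu, hu'⟩ := ih (fun ψ hψ => hS ψ (Finset.mem_insert_of_mem hψ)) hopen
      ⟨z, hz, hφz⟩ (Set.inter_subset_left.trans hVX)
    refine ⟨u, hu.1, fun ψ hψ => ?_⟩
    rcases Finset.mem_insert.mp hψ with rfl | h
    · exact hu.2
    · exact hu' ψ h

lemma hasCommonNonzeros_of_isAnalytic {n : ℕ} {X : Set (EuclideanSpace ℝ (Fin n))}
    (hX : IsPreconnected X) (hXi : (interior X).Nonempty) {F : Submodule ℝ (X → ℝ)}
    (hF : ∀ f ∈ F, IsAnalytic f) : HasCommonNonzeros F := by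
  classical
  intro S hS
  choose! φ hφ hφ' using hF
  obtain ⟨x, hx, hx'⟩ := exists_mem_forall_ne_zero hX (S.image φ) (fun ψ hψ => by
    obtain ⟨g, hg, rfl⟩ := Finset.mem_image.mp hψ
    obtain ⟨hgF, hg0⟩ := hS g hg
    obtain ⟨x, hx⟩ := Function.ne_iff.mp hg0
    exact ⟨hφ g hgF, x, x.2, by rw [← hφ' g hgF]; exact hx⟩) isOpen_interior hXi interior_subset
  refine ⟨⟨x, interior_subset hx⟩, fun g hg => ?_⟩
  rw [hφ' g (hS g hg).1]
  exact hx' _ (Finset.mem_image_of_mem _ hg)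

lemma hasCommonNonzeros_of_analyticOnNhd_univ {E : Type*} [NormedAddCommGroup E]
    [NormedSpace ℝ E] {F : Submodule ℝ (E → ℝ)} (hF : ∀ f ∈ F, AnalyticOnNhd ℝ f Set.univ) :
    HasCommonNonzeros F := by
  intro S hS
  obtain ⟨x, -, hx⟩ := exists_mem_forall_ne_zero isPreconnected_univ S (fun φ hφ => by
    obtain ⟨hφF, hφ0⟩ := hS φ hφ
    obtain ⟨x, hx⟩ := Function.ne_iff.mp hφ0
    exact ⟨hF φ hφF, x, Set.mem_univ _, hx⟩) isOpen_univ Set.univ_nonempty subset_rfl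
  exact ⟨x, hx⟩

/-- The testing lower bound for Dudley classes of rank and VC dimension `d`. -/
theorem testingLowerBound_dudleyClass {𝒳 : Type*} [MeasurableSpace 𝒳]
    [MeasurableSingletonClass 𝒳] {F : Submodule ℝ (𝒳 → ℝ)} {h : 𝒳 → ℝ}
    (hF : HasCommonNonzeros F) (hFm : ∀ f ∈ F, Measurable f) (hm : Measurable h) {d : ℕ}
    (hd : 2 ≤ d) (hrank : (d : Cardinal) ≤ Module.rank ℝ F)
    (hVC : ∀ T, Shattered (dudleyClass F h) T → T.card ≤ d) {ε : ℝ} (hε : ε < 1 / 300) :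
    TestingLowerBound (dudleyClass F h) ε (1 / 10 ^ 14) d := by
  obtain ⟨y, hy, hsh⟩ := exists_shattering_points hF hd hrank h (100 * d)
  refine testingLowerBound_of_points hd hVC hy ?_ hsh hε
  rintro g ⟨f, hf, hg⟩
  refine measurable_to_bool ?_
  have : g ⁻¹' {true} = {x | 0 ≤ f x + h x} := by
    ext x
    simp [hg, sgn]
  rw [this]
  exact measurableSet_le measurable_const ((hFm f hf).add hm)

theorem testingLowerBound_of_isAnalyticDudleyClass {n : ℕ} {X : Set (EuclideanSpace ℝ (Fin n))}
    (hX : IsPreconnected X) (hXi : (interior X).Nonempty) {H : Set (X → Bool)}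
    (hH : IsAnalyticDudleyClass H) {d : ℕ} (hd : 2 ≤ d) (hVC : vcDim H = d) {ε : ℝ}
    (hε : ε < 1 / 300) : TestingLowerBound H ε (1 / 10 ^ 14) d := by
  obtain ⟨F, h, hF, hh, rfl⟩ := hH
  have hmeas : ∀ f : X → ℝ, IsAnalytic f → Measurable f := by
    rintro f ⟨φ, hφ, hfφ⟩
    have : f = X.domRestrict φ := funext hfφ
    rw [this]
    exact (continuousOn_iff_continuous_domRestrict.mp hφ.continuousOn).measurable
  have hle : ∀ T, Shattered (dudleyClass F h) T → T.card ≤ d := by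
    intro T hT
    have h1 : (T.card : ℕ∞) ≤ vcDim (dudleyClass F h) :=
      le_iSup₂ (f := fun (T : Finset X) (_ : Shattered (dudleyClass F h) T) => (T.card : ℕ∞)) T hT
    rw [hVC] at h1
    exact_mod_cast h1
  refine testingLowerBound_dudleyClass (hasCommonNonzeros_of_isAnalytic hX hXi hF)
    (fun f hf => hmeas f (hF f hf)) (hmeas h hh) hd ?_ hle hε
  -- If the rank were below `d`, then `F` would be finite-dimensional and Dudley's inequality would
  -- give VC dimension below `d`.
  by_contra hlt
  rw [not_le] at hlt
  have hfin : FiniteDimensional ℝ F :=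
    Module.rank_lt_aleph0_iff.mp (hlt.trans (Cardinal.natCast_lt_aleph0))
  have h1 : vcDim (dudleyClass F h) ≤ Module.finrank ℝ F :=
    iSup₂_le fun T hT => by exact_mod_cast card_le_finrank_of_shattered hT
  rw [hVC] at h1
  have h2 : d ≤ Module.finrank ℝ F := by exact_mod_cast h1
  rw [← Module.finrank_eq_rank] at hlt
  have h3 : Module.finrank ℝ F < d := by exact_mod_cast hlt
  omega

/-- The testing lower bound for Dudley classes of analytic functions on a whole space. -/
theorem testingLowerBound_dudleyClass_univ {E : Type*} [NormedAddCommGroup E]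
    [NormedSpace ℝ E] [MeasurableSpace E] [BorelSpace E] {F : Submodule ℝ (E → ℝ)}
    [FiniteDimensional ℝ F] {h : E → ℝ} (hF : ∀ f ∈ F, AnalyticOnNhd ℝ f Set.univ)
    (hm : Measurable h) (hd : 2 ≤ Module.finrank ℝ F) {ε : ℝ} (hε : ε < 1 / 300) :
    TestingLowerBound (dudleyClass F h) ε (1 / 10 ^ 14) (Module.finrank ℝ F) := by
  refine testingLowerBound_dudleyClass (hasCommonNonzeros_of_analyticOnNhd_univ hF)
    (fun f hf => (continuousOn_univ.mp (hF f hf).continuousOn).measurable) hm hd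
    (Module.finrank_eq_rank ℝ F).le (fun T hT => card_le_finrank_of_shattered hT) hε

/-! ### Polynomial threshold functions, balls, trigonometric polynomials -/

/-- The function `t / log t` decreases up to `e`, so monotonicity from `2` on costs a constant
factor. It lets a lower bound on the rank replace its exact value. -/
lemma div_log_le_two_mul_div_log {d D : ℕ} (hd : 2 ≤ d) (hD : d ≤ D) :
    (d : ℝ) / Real.log d ≤ 2 * (D / Real.log D) := by
  have hd2 : (2 : ℝ) ≤ d := by exact_mod_cast hd
  have hdD : (d : ℝ) ≤ D := by exact_mod_cast hD
  have hl : Real.log 2 ≤ Real.log d := Real.log_le_log (by norm_num) hd2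
  have hl2 := Real.log_two_gt_d9
  have hL : 0 < Real.log D := Real.log_pos (by linarith)
  have h1 : Real.log D ≤ Real.log d + (D / d - 1) := by
    have := Real.log_le_sub_one_of_pos (div_pos (by linarith) (by linarith) : (0 : ℝ) < D / d)
    rw [Real.log_div (by linarith) (by linarith)] at this
    linarith
  rw [← mul_div_assoc, div_le_div_iff₀ (by linarith) hL]
  have h2 : (d : ℝ) * Real.log D ≤ d * (Real.log d + (D / d - 1)) := by gcongr
  have h3 : (d : ℝ) * (Real.log d + (D / d - 1)) = d * Real.log d + D - d := by
    field_simp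
    ring
  nlinarith

lemma TestingLowerBound.mono {𝒳 : Type*} [MeasurableSpace 𝒳] {H : Set (𝒳 → Bool)} {ε : ℝ}
    {d D : ℕ} (h : TestingLowerBound H ε (1 / 10 ^ 14) D) (hd : 2 ≤ d) (hD : d ≤ D) :
    TestingLowerBound H ε (1 / (2 * 10 ^ 14)) d := by
  have h1 : 1 / (2 * 10 ^ 14) * ((d : ℝ) / Real.log d) ≤ 1 / 10 ^ 14 * (D / Real.log D) := by
    linarith [div_log_le_two_mul_div_log hd hD]
  exact ⟨(ENNReal.ofReal_le_ofReal h1).trans h.1, (ENNReal.ofReal_le_ofReal h1).trans h.2⟩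

/-- Monomials are counted degree by degree with `multichoose` and summed. -/
lemma finrank_restrictTotalDegree (n k : ℕ) :
    Module.finrank ℝ (MvPolynomial.restrictTotalDegree (Fin n) ℝ k) = (n + k).choose k := by
  classical
  have hset : {s : Fin n →₀ ℕ | (s.sum fun _ e => e) ≤ k} =
      ((Finset.range (k + 1)).biUnion fun i =>
        (Finset.univ : Finset (Fin n)).finsuppAntidiag i : Finset (Fin n →₀ ℕ)) := by
    ext s
    simp [Finsupp.sum_fintype]
  have h1 : Module.finrank ℝ (MvPolynomial.restrictTotalDegree (Fin n) ℝ k) =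
      Nat.card {s : Fin n →₀ ℕ | (s.sum fun _ e => e) ≤ k} :=
    Module.finrank_eq_nat_card_basis (MvPolynomial.basisRestrictSupport ℝ _)
  rw [h1, hset, Nat.card_coe_set_eq, Set.ncard_coe_finset, Finset.card_biUnion]
  · simp only [Finset.card_finsuppAntidiag_nat_eq_multichoose, Finset.card_univ, Fintype.card_fin]
    rw [Nat.sum_range_multichoose, add_comm k n, ← Nat.choose_symm_add]
  · intro i _ j _ hij
    rw [Function.onFun, Finset.disjoint_left]
    intro s hs hs'
    rw [Finset.mem_finsuppAntidiag'] at hs hs'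
    exact hij (hs.1.symm.trans hs'.1)

/-- Polynomials as functions on Euclidean space. -/
def polyFun (n : ℕ) : MvPolynomial (Fin n) ℝ →ₗ[ℝ] (EuclideanSpace ℝ (Fin n) → ℝ) where
  toFun p x := MvPolynomial.eval (fun i => x i) p
  map_add' p q := by ext x; simp
  map_smul' c p := by ext x; simp

lemma polyFun_injective (n : ℕ) : Function.Injective (polyFun n) := fun _ _ h =>
  MvPolynomial.funext fun x => congrFun h (WithLp.toLp 2 x)

lemma two_le_choose_add {n k : ℕ} (hn : 1 ≤ n) (hk : 1 ≤ k) : 2 ≤ (n + k).choose k := by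
  obtain ⟨k, rfl⟩ : ∃ j, k = j + 1 := ⟨k - 1, by omega⟩
  rw [← add_assoc, Nat.choose_succ_succ']
  have := Nat.choose_pos (by omega : k ≤ n + k)
  have := Nat.choose_pos (by omega : k + 1 ≤ n + k)
  omega

lemma testingLowerBound_ptfClass {n k : ℕ} (hn : 1 ≤ n) (hk : 1 ≤ k) {ε : ℝ}
    (hε : ε < 1 / 300) :
    TestingLowerBound (ptfClass n k) ε (1 / 10 ^ 14) ((n + k).choose k) := by
  set F := (MvPolynomial.restrictTotalDegree (Fin n) ℝ k).map (polyFun n) with hF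
  have hrank : Module.finrank ℝ F = (n + k).choose k := by
    rw [hF, ← finrank_restrictTotalDegree]
    exact (Submodule.equivMapOfInjective _ (polyFun_injective n) _).finrank_eq.symm
  have h2 := two_le_choose_add hn hk
  have heq : ptfClass n k = dudleyClass F 0 := by
    ext g
    constructor
    · rintro ⟨p, hp, hg⟩
      refine ⟨polyFun n p, ⟨p, (MvPolynomial.mem_restrictTotalDegree _ _ p).mpr hp, rfl⟩,
        fun x => ?_⟩
      rw [hg, Pi.zero_apply, add_zero]
      rfl
    · rintro ⟨f, ⟨p, hp, rfl⟩, hg⟩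
      refine ⟨p, (MvPolynomial.mem_restrictTotalDegree _ _ p).mp hp, fun x => ?_⟩
      rw [hg, Pi.zero_apply, add_zero]
      rfl
  rw [heq, ← hrank]
  refine testingLowerBound_dudleyClass_univ ?_ measurable_const (by rw [hrank]; exact h2) hε
  rintro f ⟨p, -, rfl⟩
  have := AnalyticOnNhd.aeval_mvPolynomial (𝕜 := ℝ) (A := ℝ) (s := Set.univ)
    (f := fun (x : EuclideanSpace ℝ (Fin n)) i => x i)
    (fun i => (EuclideanSpace.proj (𝕜 := ℝ) i).analyticOnNhd _) p
  simpa [polyFun, MvPolynomial.aeval_eq_eval] using this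

/-- Affine functions on Euclidean space. -/
def affineFun (n : ℕ) :
    (ℝ × EuclideanSpace ℝ (Fin n)) →ₗ[ℝ] (EuclideanSpace ℝ (Fin n) → ℝ) where
  toFun v x := v.1 + inner ℝ v.2 x
  map_add' v w := by ext x; simp [inner_add_left]; ring
  map_smul' c v := by ext x; simp [inner_smul_left]; ring

lemma affineFun_injective (n : ℕ) : Function.Injective (affineFun n) := by
  rw [← LinearMap.ker_eq_bot, LinearMap.ker_eq_bot']
  rintro ⟨a, b⟩ h
  have h0 := congrFun h 0
  have h1 := congrFun h b
  simp only [affineFun, LinearMap.coe_mk, AddHom.coe_mk, inner_zero_right, add_zero,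
    Pi.zero_apply] at h0 h1
  rw [h0, zero_add, inner_self_eq_zero] at h1
  rw [h0, h1]
  rfl

/-- Squaring makes a ball `‖x‖ ^ 2 ≤` an affine function. Negative radii and negative squared radii
both give the empty ball. -/
lemma ballClass_eq_dudleyClass (n : ℕ) :
    ballClass n = dudleyClass (LinearMap.range (affineFun n)) fun x => -‖x‖ ^ 2 := by
  have key : ∀ (a : ℝ) (z x : EuclideanSpace ℝ (Fin n)),
      affineFun n (a - ‖z‖ ^ 2, (2 : ℝ) • z) x + -‖x‖ ^ 2 = a - ‖x - z‖ ^ 2 := by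
    intro a z x
    rw [norm_sub_sq_real, real_inner_comm]
    simp only [affineFun, LinearMap.coe_mk, AddHom.coe_mk, inner_smul_left, conj_trivial]
    ring
  ext g
  constructor
  · rintro ⟨t, z, hg⟩
    rcases le_or_gt 0 t with ht | ht
    · refine ⟨_, ⟨(t ^ 2 - ‖z‖ ^ 2, (2 : ℝ) • z), rfl⟩, fun x => ?_⟩
      rw [hg, key]
      simp only [sgn, decide_eq_decide, sub_nonneg]
      exact (pow_le_pow_iff_left₀ (norm_nonneg _) ht two_ne_zero).symm
    · refine ⟨_, ⟨(-1 - ‖z‖ ^ 2, (2 : ℝ) • z), rfl⟩, fun x => ?_⟩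
      rw [hg, key]
      simp only [sgn, decide_eq_decide]
      have := norm_nonneg (x - z)
      exact iff_of_false (by linarith) (by nlinarith)
  · rintro ⟨_, ⟨⟨a, b⟩, rfl⟩, hg⟩
    obtain ⟨z, rfl⟩ : ∃ z, b = (2 : ℝ) • z := ⟨(1 / 2 : ℝ) • b, by simp [smul_smul]⟩
    obtain ⟨s, rfl⟩ : ∃ s, a = s - ‖z‖ ^ 2 := ⟨a + ‖z‖ ^ 2, by ring⟩
    simp only [key] at hg
    rcases le_or_gt 0 s with hs | hs
    · refine ⟨Real.sqrt s, z, fun x => ?_⟩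
      rw [hg]
      simp only [sgn, decide_eq_decide, sub_nonneg]
      exact (Real.le_sqrt (norm_nonneg _) hs).symm
    · refine ⟨-1, z, fun x => ?_⟩
      rw [hg]
      simp only [sgn, decide_eq_decide]
      have := norm_nonneg (x - z)
      exact iff_of_false (by nlinarith) (by linarith)

lemma testingLowerBound_ballClass {n : ℕ} (hn : 2 ≤ n) {ε : ℝ} (hε : ε < 1 / 300) :
    TestingLowerBound (ballClass n) ε (1 / (2 * 10 ^ 14)) n := by
  have hrank : Module.finrank ℝ (LinearMap.range (affineFun n)) = 1 + n := by
    rw [LinearMap.finrank_range_of_inj (affineFun_injective n), Module.finrank_prod]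
    simp
  rw [ballClass_eq_dudleyClass]
  refine (testingLowerBound_dudleyClass_univ ?_ ?_ (by omega) hε).mono hn
    (by rw [hrank]; omega)
  · rintro _ ⟨⟨a, b⟩, rfl⟩
    exact analyticOnNhd_const.add ((innerSL ℝ b).analyticOnNhd _)
  · exact (measurable_norm.pow_const 2).neg

/-- Trigonometric polynomials of degree at most `d` in the first coordinate. -/
def trigPoly (d : ℕ) : Submodule ℝ (EuclideanSpace ℝ (Fin 2) → ℝ) where
  carrier := {f | ∃ (t : ℝ) (a b : ℕ → ℝ), ∀ p, f p =
    t + ∑ k ∈ Finset.Icc 1 d, a k * Real.cos (k * p 0) +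
      ∑ k ∈ Finset.Icc 1 d, b k * Real.sin (k * p 0)}
  add_mem' := by
    rintro f g ⟨t, a, b, h⟩ ⟨t', a', b', h'⟩
    refine ⟨t + t', a + a', b + b', fun p => ?_⟩
    simp only [Pi.add_apply, h, h', add_mul, Finset.sum_add_distrib]
    ring
  zero_mem' := ⟨0, 0, 0, fun p => by simp⟩
  smul_mem' := by
    rintro c f ⟨t, a, b, h⟩
    refine ⟨c * t, c • a, c • b, fun p => ?_⟩
    simp only [Pi.smul_apply, h, smul_eq_mul, mul_assoc, ← Finset.mul_sum]
    ring

instance finiteDimensional_trigPoly (d : ℕ) : FiniteDimensional ℝ (trigPoly d) := by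
  classical
  set S : Finset (EuclideanSpace ℝ (Fin 2) → ℝ) :=
    (Finset.range (d + 1)).image (fun (k : ℕ) p => Real.cos (k * p 0)) ∪
      (Finset.range (d + 1)).image (fun (k : ℕ) p => Real.sin (k * p 0)) with hS
  have hcos : ∀ k : ℕ, k ≤ d → (fun p : EuclideanSpace ℝ (Fin 2) => Real.cos (k * p 0)) ∈
      Submodule.span ℝ (S : Set (EuclideanSpace ℝ (Fin 2) → ℝ)) := fun k hk =>
    Submodule.subset_span (Finset.mem_union_left _ (Finset.mem_image_of_mem _
      (Finset.mem_range.mpr (by omega))))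
  have hsin : ∀ k : ℕ, k ≤ d → (fun p : EuclideanSpace ℝ (Fin 2) => Real.sin (k * p 0)) ∈
      Submodule.span ℝ (S : Set (EuclideanSpace ℝ (Fin 2) → ℝ)) := fun k hk =>
    Submodule.subset_span (Finset.mem_union_right _ (Finset.mem_image_of_mem _
      (Finset.mem_range.mpr (by omega))))
  have hle : trigPoly d ≤ Submodule.span ℝ (S : Set (EuclideanSpace ℝ (Fin 2) → ℝ)) := by
    rintro f ⟨t, a, b, h⟩
    have hf : f = t • (fun p : EuclideanSpace ℝ (Fin 2) => Real.cos ((0 : ℕ) * p 0)) +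
        ∑ k ∈ Finset.Icc 1 d, a k • (fun p : EuclideanSpace ℝ (Fin 2) => Real.cos (k * p 0)) +
        ∑ k ∈ Finset.Icc 1 d, b k • (fun p : EuclideanSpace ℝ (Fin 2) => Real.sin (k * p 0)) := by
      ext p
      simp [h, Finset.sum_apply]
    rw [hf]
    refine Submodule.add_mem _ (Submodule.add_mem _ (Submodule.smul_mem _ _ (hcos 0 (by omega)))
      (Submodule.sum_mem _ fun k hk => Submodule.smul_mem _ _ (hcos k (Finset.mem_Icc.mp hk).2)))
      (Submodule.sum_mem _ fun k hk => Submodule.smul_mem _ _ (hsin k (Finset.mem_Icc.mp hk).2))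
  have : FiniteDimensional ℝ (Submodule.span ℝ (S : Set (EuclideanSpace ℝ (Fin 2) → ℝ))) :=
    FiniteDimensional.span_finset ℝ S
  exact Submodule.finiteDimensional_of_le hle

/-- Polynomials in the cosine of the first coordinate. -/
def cosFun : Polynomial ℝ →ₗ[ℝ] (EuclideanSpace ℝ (Fin 2) → ℝ) where
  toFun P p := P.eval (Real.cos (p 0))
  map_add' P Q := by ext p; simp
  map_smul' c P := by ext p; simp

lemma cosFun_injective : Function.Injective cosFun := by
  intro P Q h
  refine Polynomial.eq_of_infinite_eval_eq P Q
    ((Set.Icc_infinite (by norm_num : (-1 : ℝ) < 1)).mono fun x hx => ?_)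
  have := congrFun h (WithLp.toLp 2 fun _ => Real.arccos x)
  simpa [cosFun, Real.cos_arccos hx.1 hx.2] using this

/-- The cosines alone suffice: `cos (k x)` is the `k`-th Chebyshev polynomial in `cos x`, and these
polynomials are linearly independent. -/
lemma le_finrank_trigPoly (d : ℕ) : d ≤ Module.finrank ℝ (trigPoly d) := by
  have hli : LinearIndependent ℝ fun k : Fin d =>
      cosFun (Polynomial.Chebyshev.chebyshevTsequence ℝ ((k : ℕ) + 1)) :=
    (((Polynomial.Chebyshev.chebyshevTsequence ℝ).linearIndependent.comp
      (fun k : Fin d => (k : ℕ) + 1) (fun i j h => Fin.ext (Nat.succ_injective h))).map' cosFun (LinearMap.ker_eq_bot.mpr cosFun_injective))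
  have hmem : ∀ k : Fin d,
      cosFun (Polynomial.Chebyshev.chebyshevTsequence ℝ ((k : ℕ) + 1)) ∈ trigPoly d := by
    intro k
    refine ⟨0, Pi.single ((k : ℕ) + 1) 1, 0, fun p => ?_⟩
    rw [Finset.sum_eq_single ((k : ℕ) + 1)]
    · simp only [Pi.single_eq_same, one_mul, zero_add, Pi.zero_apply, zero_mul,
        Finset.sum_const_zero, add_zero]
      simp [cosFun, Polynomial.Chebyshev.chebyshevTsequence]
    · intro j _ hj
      simp [Pi.single_eq_of_ne hj]
    · intro hk
      exact absurd (Finset.mem_Icc.mpr ⟨by omega, by omega⟩) hk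
  have hli' : LinearIndependent ℝ fun k : Fin d => (⟨_, hmem k⟩ : trigPoly d) :=
    LinearIndependent.of_comp (trigPoly d).subtype hli
  simpa using hli'.fintype_card_le_finrank

lemma testingLowerBound_trigClass {d : ℕ} (hd : 2 ≤ d) {ε : ℝ} (hε : ε < 1 / 300) :
    TestingLowerBound (trigClass d) ε (1 / (2 * 10 ^ 14)) d := by
  have heq : trigClass d = dudleyClass (trigPoly d) fun p => -p 1 := by
    ext g
    constructor
    · rintro ⟨t, a, b, hg⟩
      exact ⟨_, ⟨t, a, b, fun p => rfl⟩, fun p => by rw [hg, sub_eq_add_neg]⟩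
    · rintro ⟨f, ⟨t, a, b, hf⟩, hg⟩
      exact ⟨t, a, b, fun p => by rw [hg, hf, sub_eq_add_neg]⟩
  have hle := le_finrank_trigPoly d
  rw [heq]
  refine (testingLowerBound_dudleyClass_univ ?_ ?_ (by omega) hε).mono hd hle
  · rintro f ⟨t, a, b, hf⟩
    rw [funext hf]
    have hp : AnalyticOnNhd ℝ (fun p : EuclideanSpace ℝ (Fin 2) => p 0) Set.univ :=
      (EuclideanSpace.proj (𝕜 := ℝ) (0 : Fin 2)).analyticOnNhd _
    intro p hpu
    have hp' := hp p hpu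
    fun_prop
  · fun_prop

end DudleyTesting

end

theorem mainTheorem7 :
    ∃ ε₀ : ℝ, 0 < ε₀ ∧ ∃ c : ℝ, 0 < c ∧ ∀ ε : ℝ, 0 < ε → ε < ε₀ →
      (∀ (n : ℕ) (X : Set (EuclideanSpace ℝ (Fin n))), IsPreconnected X → (interior X).Nonempty →
        ∀ H : Set (X → Bool), DudleyTesting.IsAnalyticDudleyClass H →
          ∀ d : ℕ, 2 ≤ d → DudleyTesting.vcDim H = d →
            DudleyTesting.TestingLowerBound H ε c d) ∧
      (∀ n k : ℕ, 1 ≤ n → 1 ≤ k →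
        DudleyTesting.TestingLowerBound (DudleyTesting.ptfClass n k) ε c ((n + k).choose k)) ∧
      (∀ n : ℕ, 2 ≤ n →
        DudleyTesting.TestingLowerBound (DudleyTesting.ballClass n) ε c n) ∧
      (∀ d : ℕ, 2 ≤ d →
        DudleyTesting.TestingLowerBound (DudleyTesting.trigClass d) ε c d) := by
  -- `1 / 300` compares error mass at least `d` with total mass at most `300 * d`; the factor `2` in
  -- `c` is the loss in `TestingLowerBound.mono`.
  refine ⟨1 / 300, by norm_num, 1 / (2 * 10 ^ 14), by norm_num, fun ε _ hε => ⟨?_, ?_, ?_, ?_⟩⟩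
  · intro n X hX hXi H hH d hd hVC
    exact (DudleyTesting.testingLowerBound_of_isAnalyticDudleyClass hX hXi hH hd hVC hε).mono hd
      le_rfl
  · intro n k hn hk
    exact (DudleyTesting.testingLowerBound_ptfClass hn hk hε).mono
      (DudleyTesting.two_le_choose_add hn hk) le_rfl
  · exact fun n hn => DudleyTesting.testingLowerBound_ballClass hn hε
  · exact fun d hd => DudleyTesting.testingLowerBound_trigClass hd hε
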